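/- Let $\mathbf H_4\le \mathrm{SL}_2(\mathbb R)$ be the Hecke group generated by $\begin{pmatrix}0&-1\\1&0\end{pmatrix}$ and $\begin{pmatrix}1&\lambda\\0&1\end{pmatrix}$ with $\lambda=2\cos\frac{\pi}{4}=\sqrt2$. For a real binary quadratic form $f(x,y)=ax^2+bxy+cy^2$ write $\delta(f)=b^2-4ac$, and for $M\in\mathrm{SL}_2(\mathbb R)$ write $f(M)=f\left(M\begin{pmatrix}1\\0\end{pmatrix}\right)$. The Markoff spectrum of $\mathbf H_4$ is the set of real numbers $$\mathscr M(\mathbf H_4)=\left\{\frac{\sqrt{\delta(f)}}{\inf_{M\in\mathbf H_4}|f(M)|}\;\Big|\;\delta(f)>0\right\}\cap\mathbb R ,$$ and the Lagrange spectrum of $\mathbf H_4$ is the set of real numbers $$\mathscr L(\mathbf H_4)=\left\{\limsup_{M\in\mathbf H_4}\frac{\sqrt{\delta(f)}}{|f(M)|}\;\Big|\;\delta(f)>0,\ f\text{ does not have both its roots at cusps}\right\}\cap\mathbb R .$$ Here a quotient with denominator $0$ is $+\infty$. The limit superior runs over the distinct vectors $M\begin{pmatrix}1\\0\end{pmatrix}$,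 $M\in\mathbf H_4$, i.e. it is the infimum, over all finite sets $E$ of such vectors, of the supremum of the terms with $M\begin{pmatrix}1\\0\end{pmatrix}\notin E$. The form $f$ has both its roots at cusps if it vanishes at two linearly independent vectors of the orbit $\mathbf H_4\begin{pmatrix}1\\0\end{pmatrix}$. **Theorem (Hall's ray).** The Lagrange spectrum $\mathscr L(\mathbf H_4)$ contains every real number greater than $4\sqrt2$, and it is contained in the Markoff spectrum: $$(4\sqrt2,\infty)\subset\mathscr L(\mathbf H_4)\subset\mathscr M(\mathbf H_4).$$ -/

import Mathlib

open scoped MatrixGroups ENNReal Matrix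

noncomputable section

/-- A real binary quadratic form `a x² + b x y + c y²`. -/
structure BinForm where
  a : ℝ
  b : ℝ
  c : ℝ

/-- The value `f(x, y)` of the form at the vector `v = (x, y)`. -/
def BinForm.eval (f : BinForm) (v : Fin 2 → ℝ) : ℝ :=
  f.a * v 0 ^ 2 + f.b * v 0 * v 1 + f.c * v 1 ^ 2

/-- The discriminant `δ(f) = b² - 4 a c`. -/
def BinForm.disc (f : BinForm) : ℝ :=
  f.b ^ 2 - 4 * f.a * f.c

/-- The vector `M (1, 0)ᵀ`, that is, the first column of `M`. -/
def firstCol (M : SL(2, ℝ)) : Fin 2 → ℝ :=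
  (M : Matrix (Fin 2) (Fin 2) ℝ) *ᵥ ![1, 0]

/-- The orbit of `(1, 0)ᵀ` under `G`. -/
def cuspOrbit (G : Subgroup SL(2, ℝ)) : Set (Fin 2 → ℝ) :=
  {v | ∃ M ∈ G, firstCol M = v}

/-- The Markoff value `√δ(f) / inf_{M ∈ G} |f(M (1, 0)ᵀ)|`, which is `∞` when the infimum is `0`
and `δ(f) > 0`. -/
def markoffValue (G : Subgroup SL(2, ℝ)) (f : BinForm) : ℝ≥0∞ :=
  ENNReal.ofReal (√f.disc) / ⨅ M : G, ENNReal.ofReal |f.eval (firstCol (M : SL(2, ℝ)))|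

/-- The Markoff spectrum of `G`: all finite Markoff values of indefinite forms. -/
def markoffSpectrum (G : Subgroup SL(2, ℝ)) : Set ℝ :=
  {t | 0 ≤ t ∧ ∃ f : BinForm, 0 < f.disc ∧ markoffValue G f = ENNReal.ofReal t}

/-- The Lagrange value `limsup_{M ∈ G} √δ(f) / |f(M (1, 0)ᵀ)|`. Two matrices with the same vector
`M (1, 0)ᵀ` represent the same term, so the limit superior is taken over the infinite set of
distinct vectors of the orbit: it is the infimum, over all finite sets of vectors, of the supremum
of the terms outside that finite set. -/
def lagrangeValue (G : Subgroup SL(2, ℝ)) (f : BinForm) : ℝ≥0∞ :=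
  Filter.limsup
    (fun v : cuspOrbit G =>
      ENNReal.ofReal (√f.disc) / ENNReal.ofReal |f.eval (v : Fin 2 → ℝ)|)
    Filter.cofinite

/-- Both zero lines of `f` are spanned by vectors of the orbit of `(1, 0)ᵀ`; geometrically, the
geodesic joining the two roots of `f` runs from a cusp of `G` to a cusp of `G`. -/
def JoinsCusps (G : Subgroup SL(2, ℝ)) (f : BinForm) : Prop :=
  ∃ v ∈ cuspOrbit G, ∃ w ∈ cuspOrbit G,
    v 0 * w 1 - v 1 * w 0 ≠ 0 ∧ f.eval v = 0 ∧ f.eval w = 0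

/-- The Lagrange spectrum of `G`: all finite Lagrange values of indefinite forms at least one of
whose roots is not a cusp (the analogue of the irrationality of `ξ` in the classical spectrum; a
geodesic from cusp to cusp has infinite height, although only finitely many vectors witness it). -/
def lagrangeSpectrum (G : Subgroup SL(2, ℝ)) : Set ℝ :=
  {t | 0 ≤ t ∧ ∃ f : BinForm, 0 < f.disc ∧ ¬ JoinsCusps G f ∧
    lagrangeValue G f = ENNReal.ofReal t}

/-- The matrix `S = (0, -1; 1, 0)`. -/
def heckeS : SL(2, ℝ) :=
  ⟨!![0, -1; 1, 0], by simp [Matrix.det_fin_two]⟩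

/-- The matrix `T = (1, λ_q; 0, 1)` with `λ_q = 2 cos (π / q)`. -/
def heckeT (q : ℕ) : SL(2, ℝ) :=
  ⟨!![1, 2 * Real.cos (Real.pi / q); 0, 1], by simp [Matrix.det_fin_two]⟩

/-- The Hecke group `H_q`, generated by `S` and `T`. -/
def heckeGroup (q : ℕ) : Subgroup SL(2, ℝ) :=
  Subgroup.closure {heckeS, heckeT q}

end

/-! Lagrange inside Markoff is a compactness argument. If `f` has Lagrange value `t`, then along an
ultrafilter of distinct orbit vectors `w` one has `|f(w)| → m = √δ/t`. For each `w` choose `M` in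
the group with first column `w` and `f ∘ M` reduced (`exists_reduced`); the coefficients stay
bounded, so `f ∘ M` converges to a form `g` with the same discriminant and `|g(1,0)| = m`. If
`|g(v)| < m` for some orbit vector `v`, then `f` would be too small at `M v` for almost all `w`.
Only finitely many vectors `M v` are allowed, and each of them comes from finitely many `w`
(`finite_of_det_eq`), a contradiction. So `m` is the minimum of `|g|` on the orbit. That `t > 0`
follows from Dirichlet's theorem at a root which is not a cusp.

The ray is Hall's argument. In the coordinate `z = x/√2` the ideal square with vertices `0, 1/2, 1,
∞` gives three maps `L, M, R` sending `(0,∞)` onto `(0,1/2), (1/2,1), (1,∞)`, and a digit sequence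
encodes a positive number. The form of discriminant 1 with roots `√2 X` and `-√2 P` has the value
`1/(√2(X+P))` at `(1,0)`. Shifting along a word `w` replaces `X` by the value of the remaining
digits, while `P` becomes the value of the digits already read, read backwards
(`rootForm_eval_mat`).

Let `K` be the Cantor set of numbers whose digits avoid `LLL` and `RRR` and do not start with `R`.
At each stage of its construction every gap is shorter than the neighbouring pieces, in a form
stable under Möbius distortion (`Node.Valid.splits`); hence `K + K` contains `[1/2, 3/2]`
(`exists_add_eq`). Every `t > 4√2` can therefore be written as `√2(N + x + y)` with `x, y` in `K`.
The word `hallWord` contains, for every `k`, the first `k` digits of `y` reversed, then `R^N`, then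
the first `k` digits of `x`; at the runs `R^N` the terms tend to `t`.

All other terms are at most `4√2`, up to finitely many vectors (`DigitPath.bound`). An orbit vector
that is not a vertex of the squares along the path has `|f| ≥ 1/2`. At a vertex where no `RRR`
begins, `X ≤ 3` and `P ≤ 1`, so `√2(X+P) ≤ 4√2`; vertices of the other kind are controlled by the
absence of `LLL`. -/

/-- The explicit description of the cusp orbit of the Hecke group `H₄`. -/
def IsCuspVector (v : Fin 2 → ℝ) : Prop :=
  (∃ p q : ℤ, IsCoprime p (2 * q) ∧ v = ![(p : ℝ), q * √2]) ∨
    ∃ p q : ℤ, IsCoprime (2 * p) q ∧ v = ![p * √2, (q : ℝ)]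

/-! ### The cusp orbit of the Hecke group and its discreteness -/

theorem sqrt_two_mul_self : √(2 : ℝ) * √2 = 2 := Real.mul_self_sqrt (by norm_num)

theorem mulVec_eq (M : SL(2, ℝ)) (v : Fin 2 → ℝ) :
    (M : Matrix (Fin 2) (Fin 2) ℝ) *ᵥ v = ![M 0 0 * v 0 + M 0 1 * v 1, M 1 0 * v 0 + M 1 1 * v 1] := by
  ext i
  fin_cases i <;> simp [Matrix.mulVec, dotProduct, Fin.sum_univ_two]

theorem firstCol_eq (M : SL(2, ℝ)) : firstCol M = ![M 0 0, M 1 0] := by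
  rw [firstCol, mulVec_eq]; simp

theorem firstCol_mul (M N : SL(2, ℝ)) :
    firstCol (M * N) = (M : Matrix (Fin 2) (Fin 2) ℝ) *ᵥ firstCol N := by
  rw [firstCol, firstCol, Matrix.mulVec_mulVec, Matrix.SpecialLinearGroup.coe_mul]

theorem mulVec_mem_cuspOrbit {G : Subgroup SL(2, ℝ)} {M : SL(2, ℝ)} (hM : M ∈ G)
    {v : Fin 2 → ℝ} (hv : v ∈ cuspOrbit G) :
    (M : Matrix (Fin 2) (Fin 2) ℝ) *ᵥ v ∈ cuspOrbit G := by
  obtain ⟨N, hN, rfl⟩ := hv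
  exact ⟨M * N, G.mul_mem hM hN, firstCol_mul M N⟩

theorem vec_zero_one (v : Fin 2 → ℝ) : ![v 0, v 1] = v := by
  ext i; fin_cases i <;> rfl

/-- The unipotent matrix `(1, r; 0, 1)`. -/
def unip (r : ℝ) : SL(2, ℝ) := ⟨!![1, r; 0, 1], by simp [Matrix.det_fin_two]⟩

theorem unip_add (r s : ℝ) : unip (r + s) = unip r * unip s := by
  apply Subtype.ext
  rw [Matrix.SpecialLinearGroup.coe_mul]
  simp [unip, add_comm]

theorem unip_zero : unip 0 = 1 := by
  ext i j
  fin_cases i <;> fin_cases j <;> simp [unip]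

theorem unip_neg (r : ℝ) : unip (-r) = (unip r)⁻¹ := by
  rw [eq_inv_iff_mul_eq_one, ← unip_add]; simp [unip_zero]

theorem heckeT_four : heckeT 4 = unip √2 := by
  ext i j
  fin_cases i <;> fin_cases j <;> simp [unip, heckeT, Real.cos_pi_div_four]
  ring

theorem heckeS_mem : heckeS ∈ heckeGroup 4 := Subgroup.subset_closure (by simp)

theorem unip_sqrt_two_mem : unip √2 ∈ heckeGroup 4 :=
  heckeT_four ▸ Subgroup.subset_closure (by simp)

theorem unip_int_mem (n : ℤ) : unip (n * √2) ∈ heckeGroup 4 := by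
  induction n using Int.induction_on with
  | zero => simp [unip_zero, (heckeGroup 4).one_mem]
  | succ k ih =>
    have := (heckeGroup 4).mul_mem ih unip_sqrt_two_mem
    rw [← unip_add] at this
    convert this using 2
    push_cast; ring
  | pred k ih =>
    have := (heckeGroup 4).mul_mem ih ((heckeGroup 4).inv_mem unip_sqrt_two_mem)
    rw [← unip_neg, ← unip_add] at this
    convert this using 2
    push_cast; ring

theorem heckeS_mulVec (x y : ℝ) :
    (heckeS : Matrix (Fin 2) (Fin 2) ℝ) *ᵥ ![x, y] = ![-y, x] := by
  rw [mulVec_eq]; simp [heckeS]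

theorem unip_mulVec (r x y : ℝ) :
    (unip r : Matrix (Fin 2) (Fin 2) ℝ) *ᵥ ![x, y] = ![x + r * y, y] := by
  rw [mulVec_eq]; simp [unip]

theorem IsCuspVector.heckeS {v : Fin 2 → ℝ} (hv : IsCuspVector v) :
    IsCuspVector ((heckeS : Matrix (Fin 2) (Fin 2) ℝ) *ᵥ v) := by
  rcases hv with ⟨p, q, h, rfl⟩ | ⟨p, q, h, rfl⟩
  · refine Or.inr ⟨-q, p, ?_, ?_⟩
    · rw [mul_neg]; exact h.symm.neg_left
    · rw [heckeS_mulVec]; push_cast; simp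
  · refine Or.inl ⟨-q, p, ?_, ?_⟩
    · exact h.symm.neg_left
    · rw [heckeS_mulVec]; push_cast; simp

theorem IsCuspVector.unip {v : Fin 2 → ℝ} (hv : IsCuspVector v) (n : ℤ) :
    IsCuspVector ((unip (n * √2) : Matrix (Fin 2) (Fin 2) ℝ) *ᵥ v) := by
  rcases hv with ⟨p, q, h, rfl⟩ | ⟨p, q, h, rfl⟩
  · refine Or.inl ⟨p + n * (2 * q), q, h.add_mul_right_left n, ?_⟩
    rw [unip_mulVec]; push_cast
    congr 1
    linear_combination n * q * sqrt_two_mul_self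
  · refine Or.inr ⟨p + n * q, q, ?_, ?_⟩
    · have := h.add_mul_right_left (2 * n)
      rwa [show 2 * n * q = 2 * (n * q) by ring, ← mul_add] at this
    · rw [unip_mulVec]; push_cast
      rw [add_mul, mul_right_comm]

theorem IsCuspVector.neg {v : Fin 2 → ℝ} (hv : IsCuspVector v) : IsCuspVector (-v) := by
  rcases hv with ⟨p, q, h, rfl⟩ | ⟨p, q, h, rfl⟩
  · refine Or.inl ⟨-p, -q, ?_, by simp⟩
    rw [mul_neg]; exact h.neg_neg
  · refine Or.inr ⟨-p, -q, ?_, by simp⟩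
    rw [mul_neg]; exact h.neg_neg

theorem heckeS_inv_mulVec (v : Fin 2 → ℝ) :
    ((heckeS⁻¹ : SL(2, ℝ)) : Matrix (Fin 2) (Fin 2) ℝ) *ᵥ v =
      -((heckeS : Matrix (Fin 2) (Fin 2) ℝ) *ᵥ v) := by
  rw [mulVec_eq, mulVec_eq, Matrix.SpecialLinearGroup.SL2_inv_expl]; simp [heckeS]

theorem isCuspVector_of_mem {v : Fin 2 → ℝ} (hv : v ∈ cuspOrbit (heckeGroup 4)) :
    IsCuspVector v := by
  obtain ⟨M, hM, rfl⟩ := hv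
  suffices H : ∀ v, IsCuspVector v → IsCuspVector ((M : Matrix (Fin 2) (Fin 2) ℝ) *ᵥ v) from
    H _ (Or.inl ⟨1, 0, isCoprime_one_left, by simp⟩)
  unfold heckeGroup at hM
  induction hM using Subgroup.closure_induction'' with
  | mem x hx =>
    rintro v hv
    rcases hx with rfl | rfl
    · exact hv.heckeS
    · rw [heckeT_four]; simpa using hv.unip 1
  | inv_mem x hx =>
    rintro v hv
    rcases hx with rfl | rfl
    · rw [heckeS_inv_mulVec]; exact hv.heckeS.neg
    · rw [heckeT_four, ← unip_neg]; simpa using hv.unip (-1)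
  | one => intro v hv; simpa using hv
  | mul x y _ _ hx hy =>
    intro v hv
    have := hx _ (hy _ hv)
    rwa [Matrix.mulVec_mulVec, ← Matrix.SpecialLinearGroup.coe_mul] at this

theorem neg_mem_cuspOrbit {v : Fin 2 → ℝ} (hv : v ∈ cuspOrbit (heckeGroup 4)) :
    -v ∈ cuspOrbit (heckeGroup 4) := by
  have := mulVec_mem_cuspOrbit heckeS_mem (mulVec_mem_cuspOrbit heckeS_mem hv)
  convert this using 1
  rw [← vec_zero_one v, heckeS_mulVec, heckeS_mulVec]; simp

theorem e1_mem_cuspOrbit (G : Subgroup SL(2, ℝ)) : ![1, 0] ∈ cuspOrbit G :=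
  ⟨1, G.one_mem, by simp [firstCol]⟩

theorem mem_of_heckeS {x y : ℝ} (h : ![-y, x] ∈ cuspOrbit (heckeGroup 4)) :
    ![x, y] ∈ cuspOrbit (heckeGroup 4) := by
  have := neg_mem_cuspOrbit (mulVec_mem_cuspOrbit heckeS_mem h)
  rw [heckeS_mulVec] at this
  simpa using this

theorem mem_of_unip {x y : ℝ} (n : ℤ) (h : ![x + n * √2 * y, y] ∈ cuspOrbit (heckeGroup 4)) :
    ![x, y] ∈ cuspOrbit (heckeGroup 4) := by
  have := mulVec_mem_cuspOrbit (unip_int_mem (-n)) h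
  rw [unip_mulVec] at this
  convert this using 2
  push_cast; ring

theorem exists_abs_add_mul_le (p : ℤ) {m : ℤ} (hm : m ≠ 0) : ∃ n : ℤ, 2 * |p + n * m| ≤ |m| := by
  wlog h : 0 < m generalizing m
  · obtain ⟨n, hn⟩ := this (neg_ne_zero.2 hm) (by omega)
    exact ⟨-n, by simpa using hn⟩
  by_cases h2 : 2 * (p % m) ≤ m
  · refine ⟨-(p / m), ?_⟩
    have : p + -(p / m) * m = p % m := by rw [Int.emod_def]; ring
    rw [this, abs_of_nonneg (Int.emod_nonneg _ hm), abs_of_pos h]; exact h2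
  · refine ⟨-(p / m) - 1, ?_⟩
    have : p + (-(p / m) - 1) * m = p % m - m := by rw [Int.emod_def]; ring
    rw [this, abs_of_pos h, abs_of_neg (by have := Int.emod_lt_of_pos p h; omega)]
    omega

/-- Euclid's algorithm with nearest multiples: a translation brings `(x, y)` to `|x| ≤ |y|/√2`, and
`S` then exchanges the coordinates, so `y²` is at least halved. The induction is on a bound for
`y²`, and each step exchanges the two types of vectors. -/
theorem mem_cuspOrbit_aux (N : ℕ) :
    (∀ p q : ℤ, IsCoprime p (2 * q) → 2 * q ^ 2 < N →
      ![(p : ℝ), q * √2] ∈ cuspOrbit (heckeGroup 4)) ∧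
    (∀ p q : ℤ, IsCoprime (2 * p) q → q ^ 2 < N →
      ![p * √2, (q : ℝ)] ∈ cuspOrbit (heckeGroup 4)) := by
  induction N with
  | zero =>
    refine ⟨fun p q _ h => ?_, fun p q _ h => ?_⟩ <;> push_cast at h <;> nlinarith [sq_nonneg q]
  | succ N ih =>
    refine ⟨fun p q h hq => ?_, fun p q h hq => ?_⟩
    · rcases eq_or_ne q 0 with rfl | hq0
      · rcases Int.isUnit_iff.1 (isCoprime_zero_right.1 (by simpa using h) : IsUnit p) with rfl | rfl
        · simpa using e1_mem_cuspOrbit (heckeGroup 4)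
        · simpa using neg_mem_cuspOrbit (e1_mem_cuspOrbit (heckeGroup 4))
      · obtain ⟨n, hn⟩ := exists_abs_add_mul_le p (m := 2 * q) (by omega)
        rw [abs_mul, abs_two] at hn
        have h1 : (p + n * (2 * q)) ^ 2 ≤ q ^ 2 := sq_le_sq.2 (by omega)
        apply mem_of_unip n
        apply mem_of_heckeS
        have := ih.2 (-q) (p + n * (2 * q)) (by
          rw [mul_neg]; exact (h.add_mul_right_left n).symm.neg_left) (by
          have : 0 < q ^ 2 := by positivity
          push_cast at hq; linarith)
        convert this using 2
        · push_cast; ring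
        · congr 1; push_cast; linear_combination n * q * sqrt_two_mul_self
    · rcases eq_or_ne q 0 with rfl | hq0
      · exfalso
        have := Int.isUnit_iff.1 (isCoprime_zero_right.1 h)
        omega
      · obtain ⟨n, hn⟩ := exists_abs_add_mul_le p hq0
        have h1 : (2 * (p + n * q)) ^ 2 ≤ q ^ 2 := sq_le_sq.2 (by rw [abs_mul, abs_two]; exact hn)
        apply mem_of_unip n
        apply mem_of_heckeS
        have := ih.1 (-q) (p + n * q) (by
          have := h.add_mul_right_left (2 * n)
          apply IsCoprime.neg_left
          convert this.symm using 1; ring) (by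
          have : 0 < q ^ 2 := by positivity
          push_cast at hq; nlinarith)
        convert this using 2
        · push_cast; ring
        · congr 1; push_cast; ring

theorem mem_cuspOrbit_iff {v : Fin 2 → ℝ} :
    v ∈ cuspOrbit (heckeGroup 4) ↔ IsCuspVector v := by
  refine ⟨isCuspVector_of_mem, ?_⟩
  rintro (⟨p, q, h, rfl⟩ | ⟨p, q, h, rfl⟩)
  · exact (mem_cuspOrbit_aux ((2 * q ^ 2).toNat + 1)).1 p q h (by push_cast; omega)
  · exact (mem_cuspOrbit_aux ((q ^ 2).toNat + 1)).2 p q h (by push_cast; omega)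

theorem one_le_sqrt_two : 1 ≤ √(2 : ℝ) := Real.one_le_sqrt.2 (by norm_num)

theorem one_le_abs_cast {n : ℤ} (h : n ≠ 0) : 1 ≤ |(n : ℝ)| := by
  exact_mod_cast Int.one_le_abs h

theorem one_le_abs_cast_mul {n : ℤ} (h : n ≠ 0) : 1 ≤ |n * √(2 : ℝ)| := by
  rw [abs_mul, abs_of_nonneg (Real.sqrt_nonneg 2)]
  exact one_le_mul_of_one_le_of_one_le (one_le_abs_cast h) one_le_sqrt_two

theorem IsCuspVector.one_le_abs_zero {v : Fin 2 → ℝ} (hv : IsCuspVector v) (h : v 0 ≠ 0) :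
    1 ≤ |v 0| := by
  rcases hv with ⟨p, q, -, rfl⟩ | ⟨p, q, -, rfl⟩
  · exact one_le_abs_cast (by simpa using h)
  · exact one_le_abs_cast_mul (by simpa using h)

theorem IsCuspVector.one_le_abs_one {v : Fin 2 → ℝ} (hv : IsCuspVector v) (h : v 1 ≠ 0) :
    1 ≤ |v 1| := by
  rcases hv with ⟨p, q, -, rfl⟩ | ⟨p, q, -, rfl⟩
  · exact one_le_abs_cast_mul (by simpa using h)
  · exact one_le_abs_cast (by simpa using h)

theorem IsCuspVector.eq_of_one_eq_zero {v : Fin 2 → ℝ} (hv : IsCuspVector v) (h : v 1 = 0) :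
    v = ![1, 0] ∨ v = ![-1, 0] := by
  rcases hv with ⟨p, q, hpq, rfl⟩ | ⟨p, q, hpq, rfl⟩
  · have hq : q = 0 := by simpa using h
    subst hq
    rcases Int.isUnit_iff.1 (isCoprime_zero_right.1 (by simpa using hpq) : IsUnit p) with rfl | rfl <;> simp
  · have hq : q = 0 := by simpa using h
    subst hq
    have := Int.isUnit_iff.1 (isCoprime_zero_right.1 hpq)
    omega

theorem IsCuspVector.eq_of_zero_eq_zero {v : Fin 2 → ℝ} (hv : IsCuspVector v) (h : v 0 = 0) :
    v = ![0, 1] ∨ v = ![0, -1] := by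
  have h1 := hv.heckeS.eq_of_one_eq_zero
  rw [← vec_zero_one v, heckeS_mulVec] at h1
  rw [← vec_zero_one v]
  rcases h1 (by simpa using h) with h2 | h2
  · right
    have := congrFun h2 0
    simp only [Matrix.cons_val_zero] at this
    rw [h, ← this, neg_neg]
  · left
    have := congrFun h2 0
    simp only [Matrix.cons_val_zero, neg_inj] at this
    rw [h, this]

theorem finite_isCuspVector (C : ℝ) :
    {v : Fin 2 → ℝ | IsCuspVector v ∧ |v 0| ≤ C ∧ |v 1| ≤ C}.Finite := by
  have hfin : (Set.Icc (-⌈C⌉) ⌈C⌉ ×ˢ Set.Icc (-⌈C⌉) ⌈C⌉ : Set (ℤ × ℤ)).Finite :=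
    (Set.finite_Icc _ _).prod (Set.finite_Icc _ _)
  have key : ∀ n : ℤ, |(n : ℝ)| ≤ C → n ∈ Set.Icc (-⌈C⌉) ⌈C⌉ := fun n hn => by
    rw [Set.mem_Icc, ← abs_le]
    exact_mod_cast hn.trans (Int.le_ceil C)
  have key2 : ∀ n : ℤ, |n * √(2 : ℝ)| ≤ C → n ∈ Set.Icc (-⌈C⌉) ⌈C⌉ := fun n hn => by
    refine key n (le_trans ?_ hn)
    rw [abs_mul, abs_of_nonneg (Real.sqrt_nonneg 2)]
    exact le_mul_of_one_le_right (abs_nonneg _) one_le_sqrt_two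
  refine ((hfin.image fun x : ℤ × ℤ => ![(x.1 : ℝ), x.2 * √2]).union
    (hfin.image fun x : ℤ × ℤ => ![x.1 * √2, (x.2 : ℝ)])).subset ?_
  rintro v ⟨⟨p, q, -, rfl⟩ | ⟨p, q, -, rfl⟩, h0, h1⟩
  · exact Or.inl ⟨(p, q), ⟨key p (by simpa using h0), key2 q (by simpa using h1)⟩, rfl⟩
  · exact Or.inr ⟨(p, q), ⟨key2 p (by simpa using h0), key q (by simpa using h1)⟩, rfl⟩

/-! ### Forms on the orbit: finiteness and reduction -/

/-- The form `v ↦ f(M v)`. -/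
def BinForm.comp (f : BinForm) (M : SL(2, ℝ)) : BinForm where
  a := f.a * M 0 0 ^ 2 + f.b * M 0 0 * M 1 0 + f.c * M 1 0 ^ 2
  b := 2 * f.a * M 0 0 * M 0 1 + f.b * (M 0 0 * M 1 1 + M 0 1 * M 1 0) + 2 * f.c * M 1 0 * M 1 1
  c := f.a * M 0 1 ^ 2 + f.b * M 0 1 * M 1 1 + f.c * M 1 1 ^ 2

theorem BinForm.eval_comp (f : BinForm) (M : SL(2, ℝ)) (v : Fin 2 → ℝ) :
    (f.comp M).eval v = f.eval ((M : Matrix (Fin 2) (Fin 2) ℝ) *ᵥ v) := by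
  rw [mulVec_eq]
  simp only [BinForm.eval, BinForm.comp, Matrix.cons_val_zero, Matrix.cons_val_one]
  ring

theorem SL_det_eq (M : SL(2, ℝ)) : M 0 0 * M 1 1 - M 0 1 * M 1 0 = 1 := by
  rw [← Matrix.det_fin_two]; exact M.2

theorem BinForm.disc_comp (f : BinForm) (M : SL(2, ℝ)) : (f.comp M).disc = f.disc := by
  have h := SL_det_eq M
  have : (f.comp M).disc = f.disc * (M 0 0 * M 1 1 - M 0 1 * M 1 0) ^ 2 := by
    simp only [BinForm.disc, BinForm.comp]; ring
  rw [this, h]; ring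

theorem BinForm.comp_a (f : BinForm) (M : SL(2, ℝ)) : (f.comp M).a = f.eval (firstCol M) := by
  rw [firstCol_eq]; simp [BinForm.eval, BinForm.comp]

theorem exists_bound_of_abs_quadratic_le {a b c C : ℝ} (h : a ≠ 0 ∨ b ≠ 0) :
    ∃ K, ∀ x : ℝ, |a * x ^ 2 + b * x + c| ≤ C → |x| ≤ K := by
  rcases eq_or_ne a 0 with rfl | ha
  · have hb : 0 < |b| := abs_pos.2 (by simpa using h)
    refine ⟨(C + |c|) / |b|, fun x hx => ?_⟩
    rw [le_div_iff₀ hb, mul_comm, ← abs_mul]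
    have : b * x = (0 * x ^ 2 + b * x + c) - c := by ring
    rw [this]
    exact (abs_sub _ _).trans (by linarith)
  · have ha' : 0 < |a| := abs_pos.2 ha
    refine ⟨max 1 ((C + |c| + |b|) / |a|), fun x hx => ?_⟩
    rcases le_total |x| 1 with h1 | h1
    · exact le_max_of_le_left h1
    · refine le_max_of_le_right ?_
      rw [le_div_iff₀ ha']
      have hC : 0 ≤ C := (abs_nonneg _).trans hx
      have h2 : |a| * |x| ^ 2 ≤ C + |b| * |x| + |c| := by
        rw [← abs_pow, ← abs_mul, ← abs_mul]
        have : a * x ^ 2 = (a * x ^ 2 + b * x + c) - b * x - c := by ring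
        rw [this]
        refine (abs_sub _ _).trans ?_
        have := abs_sub (a * x ^ 2 + b * x + c) (b * x)
        linarith
      have h3 : C + |b| * |x| + |c| ≤ (C + |c| + |b|) * |x| := by
        nlinarith [mul_nonneg hC (sub_nonneg.2 h1), mul_nonneg (abs_nonneg c) (sub_nonneg.2 h1)]
      have h4 : |x| * |a| * |x| ≤ (C + |c| + |b|) * |x| := by nlinarith
      exact le_of_mul_le_mul_right h4 (by linarith)

/-- Moving `w` to `(1, 0)` turns the determinant condition into a fixed second coordinate. The
transformed form is then a quadratic polynomial in the first coordinate, nonconstant because the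
discriminant is positive (unless `D = 0`, which leaves two vectors), and the orbit is discrete. -/
theorem finite_of_det_eq {f : BinForm} (hf : 0 < f.disc) {w : Fin 2 → ℝ}
    (hw : w ∈ cuspOrbit (heckeGroup 4)) (D C : ℝ) :
    {v : Fin 2 → ℝ | v ∈ cuspOrbit (heckeGroup 4) ∧ v 0 * w 1 - v 1 * w 0 = D ∧
      |f.eval v| ≤ C}.Finite := by
  obtain ⟨M, hM, rfl⟩ := hw
  have hfin : {u : Fin 2 → ℝ | IsCuspVector u ∧ u 1 = -D ∧ |(f.comp M).eval u| ≤ C}.Finite := by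
    rcases eq_or_ne D 0 with rfl | hD
    · refine (Set.toFinite {![1, 0], ![-1, 0]}).subset ?_
      rintro u ⟨hu, h1, -⟩
      exact hu.eq_of_one_eq_zero (by simpa using h1)
    · have hd : (f.comp M).a ≠ 0 ∨ (f.comp M).b * -D ≠ 0 := by
        by_contra! h
        have h2 : (f.comp M).b = 0 := by simpa [hD] using h.2
        rw [← f.disc_comp M, BinForm.disc, h.1, h2] at hf
        simp at hf
      obtain ⟨K, hK⟩ := exists_bound_of_abs_quadratic_le (c := (f.comp M).c * (-D) ^ 2) (C := C) hd
      refine (finite_isCuspVector (max K |D|)).subset ?_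
      rintro u ⟨hu, h1, h2⟩
      refine ⟨hu, le_max_of_le_left (hK _ ?_), le_max_of_le_right (by rw [h1, abs_neg])⟩
      rw [BinForm.eval, h1] at h2
      convert h2 using 2; ring
  refine (hfin.image fun u => (M : Matrix (Fin 2) (Fin 2) ℝ) *ᵥ u).subset ?_
  rintro v ⟨hv, hD, hC⟩
  have hinv : (M : Matrix (Fin 2) (Fin 2) ℝ) *ᵥ
      (((M⁻¹ : SL(2, ℝ)) : Matrix (Fin 2) (Fin 2) ℝ) *ᵥ v) = v := by
    rw [Matrix.mulVec_mulVec, ← Matrix.SpecialLinearGroup.coe_mul, mul_inv_cancel]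
    simp
  refine ⟨_, ⟨isCuspVector_of_mem (mulVec_mem_cuspOrbit (Subgroup.inv_mem _ hM) hv), ?_, ?_⟩, hinv⟩
  · rw [← hD, mulVec_eq, Matrix.SpecialLinearGroup.SL2_inv_expl, firstCol_eq]
    simp; ring
  · rw [BinForm.eval_comp, hinv]; exact hC

theorem ofReal_div_abs_le_iff {d x s : ℝ} (hd : 0 < d) (hs : 0 ≤ s) :
    ENNReal.ofReal d / ENNReal.ofReal |x| ≤ ENNReal.ofReal s ↔ d ≤ s * |x| := by
  rcases eq_or_ne x 0 with rfl | hx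
  · simp [ENNReal.div_zero, hd.not_ge]
  · have hx' : 0 < |x| := abs_pos.2 hx
    rw [← ENNReal.ofReal_div_of_pos hx', ENNReal.ofReal_le_ofReal_iff hs, div_le_iff₀ hx']

theorem finite_of_lt_of_lagrangeValue {G : Subgroup SL(2, ℝ)} {f : BinForm} (hf : 0 < f.disc)
    {t s : ℝ} (ht : 0 ≤ t) (h : lagrangeValue G f = ENNReal.ofReal t) (hs : t < s) :
    {v : cuspOrbit G | s * |f.eval v| < √f.disc}.Finite := by
  have h1 : lagrangeValue G f < ENNReal.ofReal s := by
    rw [h]; exact (ENNReal.ofReal_lt_ofReal_iff (ht.trans_lt hs)).2 hs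
  have h2 := Filter.eventually_lt_of_limsup_lt h1
  rw [Filter.eventually_cofinite] at h2
  refine h2.subset fun v hv => ?_
  intro hlt
  have := (ofReal_div_abs_le_iff (Real.sqrt_pos.2 hf) (ht.trans hs.le)).1 hlt.le
  exact absurd this (not_le.2 hv)

theorem infinite_of_lagrangeValue_lt {G : Subgroup SL(2, ℝ)} {f : BinForm} (hf : 0 < f.disc)
    {t s : ℝ} (hs0 : 0 ≤ s) (h : lagrangeValue G f = ENNReal.ofReal t) (hs : s < t) :
    {v : cuspOrbit G | s * |f.eval v| < √f.disc}.Infinite := by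
  have h1 : ENNReal.ofReal s < lagrangeValue G f := by
    rw [h]; exact (ENNReal.ofReal_lt_ofReal_iff (hs0.trans_lt hs)).2 hs
  have h2 := Filter.frequently_lt_of_lt_limsup (by isBoundedDefault) h1
  rw [Filter.frequently_cofinite_iff_infinite] at h2
  refine h2.mono fun v hv => ?_
  by_contra hlt
  exact absurd ((ofReal_div_abs_le_iff (Real.sqrt_pos.2 hf) hs0).2 (not_lt.1 hlt)) (not_le.2 hv)

theorem mul_unip_apply (M : SL(2, ℝ)) (r : ℝ) (i : Fin 2) :
    (M * unip r) i 0 = M i 0 ∧ (M * unip r) i 1 = M i 0 * r + M i 1 := by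
  have : ((M * unip r : SL(2, ℝ)) : Matrix (Fin 2) (Fin 2) ℝ) =
      (M : Matrix (Fin 2) (Fin 2) ℝ) * !![1, r; 0, 1] := Matrix.SpecialLinearGroup.coe_mul _ _
  rw [this]
  simp [Matrix.mul_apply, Fin.sum_univ_two]

/-- The matrices with first column `w` include `M T ^ n`, and this changes the middle coefficient by
`2√2 n f(w)`; the nearest integer makes it at most half a period. -/
theorem exists_reduced (f : BinForm) {w : Fin 2 → ℝ} (hw : w ∈ cuspOrbit (heckeGroup 4))
    (h0 : f.eval w ≠ 0) :
    ∃ M ∈ heckeGroup 4, firstCol M = w ∧ |(f.comp M).b| ≤ √2 * |f.eval w| := by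
  obtain ⟨M, hM, rfl⟩ := hw
  set a := f.eval (firstCol M) with ha
  have h2 : (0 : ℝ) < √2 := by positivity
  set n : ℤ := round (-(f.comp M).b / (2 * √2 * a)) with hn
  refine ⟨M * unip (n * √2), Subgroup.mul_mem _ hM (unip_int_mem n), ?_, ?_⟩
  · rw [firstCol_eq, firstCol_eq, (mul_unip_apply M _ 0).1, (mul_unip_apply M _ 1).1]
  · have hb : (f.comp (M * unip (n * √2))).b = (f.comp M).b + 2 * a * (n * √2) := by
      rw [ha, ← BinForm.comp_a]
      simp only [BinForm.comp, mul_unip_apply]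
      ring
    have h3 := abs_sub_round (-(f.comp M).b / (2 * √2 * a))
    rw [← hn] at h3
    have h4 : (f.comp M).b + 2 * a * (n * √2) =
        -(2 * √2 * a) * (-(f.comp M).b / (2 * √2 * a) - n) := by
      field_simp
      ring
    rw [hb, h4, abs_mul, abs_neg, abs_mul, abs_mul, abs_two, abs_of_pos h2]
    calc 2 * √2 * |a| * _ ≤ 2 * √2 * |a| * (1 / 2) := by gcongr
      _ = √2 * |a| := by ring

/-! ### Approximation of a root by cusps -/

/-- Every rational number `q` is the direction `v 0 / (√2 v 1)` of a vector of the cusp orbit. -/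
theorem exists_cuspVector_of_rat (q : ℚ) :
    ∃ v ∈ cuspOrbit (heckeGroup 4), ∃ s : ℝ, 0 < s ∧ s ≤ 1 ∧ v 0 = s * (q.num * √2) ∧
      v 1 = s * q.den := by
  have hc : IsCoprime q.num (q.den : ℤ) := by
    rw [Int.isCoprime_iff_gcd_eq_one]; exact q.reduced
  rcases Nat.even_or_odd' q.den with ⟨k, hk | hk⟩
  · have h2 : √(2 : ℝ)⁻¹ * √2 = 1 := by
      rw [← Real.sqrt_mul (by norm_num)]; norm_num
    refine ⟨![(q.num : ℝ), (k : ℤ) * √2], mem_cuspOrbit_iff.2 (Or.inl ⟨q.num, k, ?_, rfl⟩),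
      √(2 : ℝ)⁻¹, by positivity, Real.sqrt_le_one.2 (by norm_num), ?_, ?_⟩
    · rw [hk] at hc; exact_mod_cast hc
    · simp only [Matrix.cons_val_zero]; linear_combination -(q.num : ℝ) * h2
    · rw [hk]
      simp only [Matrix.cons_val_one]
      push_cast
      linear_combination (-(k : ℝ) * √2) * h2 + (k * √(2 : ℝ)⁻¹) * sqrt_two_mul_self
  · refine ⟨![q.num * √2, ((q.den : ℤ) : ℝ)], mem_cuspOrbit_iff.2 (Or.inr ⟨q.num, q.den, ?_, rfl⟩),
      1, one_pos, le_rfl, ?_, ?_⟩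
    · refine IsCoprime.mul_left ?_ hc
      rw [hk]
      exact ⟨-k, 1, by push_cast; ring⟩
    · simp
    · simp

/-- Up to the factor `√2` the finite cusps are the rational numbers, so `r / √2` is irrational and
Dirichlet's theorem gives infinitely many cusp vectors for which the factor vanishing at `r` is
`O(1/den)`, while the other factor is `O(den)`. -/
theorem infinite_of_noncusp_root {f : BinForm} {r K₁ K₂ : ℝ}
    (hf : ∀ v, f.eval v = (v 0 - r * v 1) * (K₁ * v 0 + K₂ * v 1))
    (hr : ∀ v ∈ cuspOrbit (heckeGroup 4), v 0 = r * v 1 → v 1 = 0) :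
    ∃ C, {v : cuspOrbit (heckeGroup 4) | |f.eval v| ≤ C}.Infinite := by
  have h2 : (0 : ℝ) < √2 := by positivity
  have hirr : Irrational (r / √2) := by
    rintro ⟨q, hq⟩
    obtain ⟨v, hv, s, hs, -, h0, h1⟩ := exists_cuspVector_of_rat q
    have hq' : r = q * √2 := by rw [hq]; field_simp
    have hden : (q.den : ℝ) ≠ 0 := by exact_mod_cast q.den_nz
    have := hr v hv (by
      rw [h0, h1, hq', Rat.cast_def q]
      field_simp)
    rw [h1] at this
    exact (mul_ne_zero hs.ne' hden) this
  have hinf := Real.infinite_rat_abs_sub_lt_one_div_den_sq_of_irrational hirr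
  choose v hv s hs hs1 h0 h1 using exists_cuspVector_of_rat
  have hratio : ∀ q : ℚ, v q 0 / v q 1 = q * √2 := fun q => by
    have hden : (q.den : ℝ) ≠ 0 := by exact_mod_cast q.den_nz
    have := (hs q).ne'
    rw [h0, h1, Rat.cast_def q]
    field_simp
  have hinj : Function.Injective fun q : ℚ => (⟨v q, hv q⟩ : cuspOrbit (heckeGroup 4)) := by
    intro q q' h
    have h3 : v q = v q' := congrArg Subtype.val h
    have h4 := hratio q
    rw [h3, hratio q'] at h4
    exact_mod_cast (mul_right_cancel₀ h2.ne' h4).symm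
  refine ⟨√2 * (|K₁| * √2 + |K₁ * r + K₂|), (hinf.image hinj.injOn).mono ?_⟩
  rintro _ ⟨q, hq, rfl⟩
  have hd1 : (1 : ℝ) ≤ q.den := by exact_mod_cast q.den_pos
  have hd0 : (0 : ℝ) < q.den := by linarith
  have hx : |v q 0 - r * v q 1| ≤ √2 / q.den := by
    have : v q 0 - r * v q 1 = -(s q * (√2 * q.den) * (r / √2 - q)) := by
      rw [h0, h1, Rat.cast_def q]
      field_simp
      ring
    rw [this, abs_neg, abs_mul, abs_of_pos (by have := hs q; positivity)]
    calc s q * (√2 * q.den) * |r / √2 - q| ≤ 1 * (√2 * q.den) * (1 / (q.den : ℝ) ^ 2) := by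
          gcongr
          · exact hs1 q
          · exact (Set.mem_ofPred.1 hq).le
      _ = √2 / q.den := by field_simp
  have hx2 : √2 / (q.den : ℝ) ≤ √2 := div_le_self h2.le hd1
  have hy : |v q 1| ≤ q.den := by
    rw [h1, abs_mul, abs_of_pos (hs q), abs_of_pos hd0]
    exact mul_le_of_le_one_left hd0.le (hs1 q)
  have hz : |K₁ * v q 0 + K₂ * v q 1| ≤ (|K₁| * √2 + |K₁ * r + K₂|) * q.den := by
    have : K₁ * v q 0 + K₂ * v q 1 = K₁ * (v q 0 - r * v q 1) + (K₁ * r + K₂) * v q 1 := by ring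
    rw [this]
    refine (abs_add_le _ _).trans ?_
    rw [abs_mul, abs_mul, add_mul]
    refine add_le_add ?_ (by gcongr)
    rw [mul_assoc]
    exact mul_le_mul_of_nonneg_left ((hx.trans hx2).trans (le_mul_of_one_le_right h2.le hd1))
      (abs_nonneg _)
  rw [Set.mem_ofPred_eq, hf, abs_mul]
  calc _ ≤ √2 / q.den * ((|K₁| * √2 + |K₁ * r + K₂|) * q.den) := by gcongr
    _ = _ := by field_simp

theorem exists_infinite_bounded {f : BinForm} (hf : 0 < f.disc)
    (hJ : ¬ JoinsCusps (heckeGroup 4) f) :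
    ∃ C, {v : cuspOrbit (heckeGroup 4) | |f.eval v| ≤ C}.Infinite := by
  by_cases ha : f.a = 0
  · have hb : f.b ≠ 0 := by
      rintro hb; simp [BinForm.disc, ha, hb] at hf
    -- One root is `∞`, the cusp of `(1, 0)`, so the finite root cannot be a cusp.
    refine infinite_of_noncusp_root (r := -f.c / f.b) (K₁ := 0) (K₂ := f.b) (fun v => ?_)
      fun v hv h => ?_
    · rw [BinForm.eval, ha]; field_simp; ring
    · by_contra h1
      refine hJ ⟨v, hv, _, e1_mem_cuspOrbit _, by simpa using h1, ?_, ?_⟩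
      · rw [BinForm.eval, ha, h]; field_simp; ring
      · simp [BinForm.eval, ha]
  · set d := √f.disc with hd
    have hd0 : 0 < d := Real.sqrt_pos.2 hf
    have hdd : d * d = f.b ^ 2 - 4 * f.a * f.c := Real.mul_self_sqrt hf.le
    have hfac : ∀ v, f.eval v =
        (v 0 - (-f.b + d) / (2 * f.a) * v 1) * (f.a * v 0 + (f.b + d) / 2 * v 1) := by
      intro v
      rw [BinForm.eval]; field_simp; linear_combination (v 1) ^ 2 * hdd
    have hfac' : ∀ v, f.eval v =
        (v 0 - (-f.b - d) / (2 * f.a) * v 1) * (f.a * v 0 + (f.b - d) / 2 * v 1) := by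
      intro v
      rw [BinForm.eval]; field_simp; linear_combination (v 1) ^ 2 * hdd
    by_cases h1 : ∀ v ∈ cuspOrbit (heckeGroup 4), v 0 = (-f.b + d) / (2 * f.a) * v 1 → v 1 = 0
    · exact infinite_of_noncusp_root hfac h1
    by_cases h2 : ∀ v ∈ cuspOrbit (heckeGroup 4), v 0 = (-f.b - d) / (2 * f.a) * v 1 → v 1 = 0
    · exact infinite_of_noncusp_root hfac' h2
    push Not at h1 h2
    obtain ⟨v, hv, hv0, hv1⟩ := h1
    obtain ⟨w, hw, hw0, hw1⟩ := h2
    refine (hJ ⟨v, hv, w, hw, ?_, ?_, ?_⟩).elim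
    · have : v 0 * w 1 - v 1 * w 0 = d / f.a * (v 1 * w 1) := by
        rw [hv0, hw0]; field_simp; ring
      rw [this]
      positivity
    · rw [hfac, hv0]; ring
    · rw [hfac', hw0]; ring

/-- Infinitely many orbit vectors with bounded `|f|` keep the limit superior away from `0`. -/
theorem pos_of_mem_lagrange {f : BinForm} (hf : 0 < f.disc)
    (hJ : ¬ JoinsCusps (heckeGroup 4) f) {t : ℝ} (ht : 0 ≤ t)
    (h : lagrangeValue (heckeGroup 4) f = ENNReal.ofReal t) : 0 < t := by
  refine lt_of_le_of_ne ht ?_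
  rintro rfl
  obtain ⟨C, hC⟩ := exists_infinite_bounded hf hJ
  have hd : 0 < √f.disc := Real.sqrt_pos.2 hf
  refine hC ((finite_of_lt_of_lagrangeValue hf le_rfl h
    (show 0 < √f.disc / (|C| + 1) by positivity)).subset fun v hv => ?_)
  have hv : |f.eval v| ≤ C := hv
  rw [Set.mem_ofPred_eq, div_mul_eq_mul_div, div_lt_iff₀ (by positivity)]
  gcongr
  linarith [le_abs_self C]

/-! ### Lagrange values are Markoff values, by compactness -/

theorem det_mulVec (M : SL(2, ℝ)) (v : Fin 2 → ℝ) :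
    firstCol M 0 * ((M : Matrix (Fin 2) (Fin 2) ℝ) *ᵥ v) 1 -
      firstCol M 1 * ((M : Matrix (Fin 2) (Fin 2) ℝ) *ᵥ v) 0 = v 1 := by
  rw [firstCol_eq, mulVec_eq]
  simp only [Matrix.cons_val_zero, Matrix.cons_val_one]
  linear_combination v 1 * SL_det_eq M

/-- The number `√δ/t` is a cluster value of `|f|` along the orbit: infinitely many vectors have
`|f|` below any larger number, and only finitely many below any smaller positive one. -/
theorem exists_ultrafilter {f : BinForm} (hf : 0 < f.disc) {t : ℝ} (ht : 0 < t)
    {G : Subgroup SL(2, ℝ)} (h : lagrangeValue G f = ENNReal.ofReal t) :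
    ∃ U : Ultrafilter (cuspOrbit G), (U : Filter (cuspOrbit G)) ≤ Filter.cofinite ∧
      Filter.Tendsto (fun v : cuspOrbit G => |f.eval v|) U (nhds (√f.disc / t)) := by
  have hd : 0 < √f.disc := Real.sqrt_pos.2 hf
  set m := √f.disc / t with hm
  have hm0 : 0 < m := by positivity
  have hne : (Filter.cofinite ⊓
      Filter.comap (fun v : cuspOrbit G => |f.eval v|) (nhds m)).NeBot := by
    rw [Filter.inf_neBot_iff]
    rintro A hA B ⟨B', hB', hB⟩
    obtain ⟨ε, hε, hεB⟩ := Metric.mem_nhds_iff.1 hB'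
    -- The bound `m / 2` keeps `m` minus this number positive, so that one may divide by it.
    have hε' : 0 < min (ε / 2) (m / 2) := by positivity
    have h1 := infinite_of_lagrangeValue_lt hf (s := √f.disc / (m + min (ε / 2) (m / 2)))
      (by positivity) h (by
        rw [div_lt_iff₀ (by positivity)]
        have : √f.disc = t * m := by rw [hm]; field_simp
        rw [this]; gcongr; linarith)
    have hlt : 0 < m - min (ε / 2) (m / 2) := by have := min_le_right (ε / 2) (m / 2); linarith
    have h2 := finite_of_lt_of_lagrangeValue hf (s := √f.disc / (m - min (ε / 2) (m / 2))) ht.le h (by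
        rw [lt_div_iff₀ hlt]
        have : √f.disc = t * m := by rw [hm]; field_simp
        rw [this]; gcongr; linarith)
    obtain ⟨v, ⟨hv1, hv2⟩, hv3⟩ := ((h1.sdiff h2).sdiff (Filter.mem_cofinite.1 hA)).nonempty
    refine ⟨v, by simpa using hv3, hB (hεB ?_)⟩
    rw [Set.mem_ofPred_eq, div_mul_eq_mul_div, div_lt_iff₀ (by positivity),
      mul_lt_mul_iff_right₀ hd] at hv1
    rw [Set.mem_ofPred_eq, div_mul_eq_mul_div, div_lt_iff₀ hlt,
      mul_lt_mul_iff_right₀ hd] at hv2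
    have := min_le_left (ε / 2) (m / 2)
    rw [Metric.mem_ball, Real.dist_eq, abs_lt]
    dsimp only
    constructor <;> linarith
  refine ⟨Ultrafilter.of (Filter.cofinite ⊓
      Filter.comap (fun v : cuspOrbit G => |f.eval v|) (nhds m)), (Ultrafilter.of_le _).trans inf_le_left, ?_⟩
  exact Filter.tendsto_iff_comap.2 ((Ultrafilter.of_le _).trans inf_le_right)

theorem exists_tendsto_of_abs_le {α : Type*} (U : Ultrafilter α) {φ : α → ℝ} {C : ℝ}
    (h : ∀ᶠ x in (U : Filter α), |φ x| ≤ C) : ∃ l, Filter.Tendsto φ U (nhds l) := by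
  obtain ⟨l, -, hl⟩ := (isCompact_Icc (a := -C) (b := C)).ultrafilter_le_nhds (U.map φ) (by
    rw [Filter.le_principal_iff]
    exact h.mono fun x hx => abs_le.1 hx)
  exact ⟨l, hl⟩

theorem lagrangeSpectrum_subset_markoffSpectrum :
    lagrangeSpectrum (heckeGroup 4) ⊆ markoffSpectrum (heckeGroup 4) := by
  rintro t ⟨ht0, f, hf, hJ, h⟩
  refine ⟨ht0, ?_⟩
  have ht := pos_of_mem_lagrange hf hJ ht0 h
  have hd : 0 < √f.disc := Real.sqrt_pos.2 hf
  obtain ⟨U, hUc, hUm⟩ := exists_ultrafilter hf ht h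
  set m := √f.disc / t with hm
  have hm0 : 0 < m := by positivity
  have hM : ∀ w : cuspOrbit (heckeGroup 4), ∃ M ∈ heckeGroup 4, firstCol M = w ∧
      (f.eval w ≠ 0 → |(f.comp M).b| ≤ √2 * |f.eval w|) := by
    rintro ⟨w, hw⟩
    by_cases h0 : f.eval w = 0
    · obtain ⟨M, hM, hMw⟩ := hw
      exact ⟨M, hM, hMw, fun h1 => (h1 h0).elim⟩
    · obtain ⟨M, hM, hMw, hb⟩ := exists_reduced f hw h0
      exact ⟨M, hM, hMw, fun _ => hb⟩
  choose M hMG hMw hMb using hM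
  have ha : ∀ w, (f.comp (M w)).a = f.eval w := fun w => by rw [BinForm.comp_a, hMw]
  have hlow : ∀ᶠ w : cuspOrbit (heckeGroup 4) in U, m / 2 < |f.eval (w : Fin 2 → ℝ)| :=
    hUm.eventually_const_lt (by linarith)
  have hup : ∀ᶠ w : cuspOrbit (heckeGroup 4) in U, |f.eval (w : Fin 2 → ℝ)| < 2 * m :=
    hUm.eventually_lt_const (by linarith)
  obtain ⟨a, hatend⟩ := exists_tendsto_of_abs_le U (hup.mono fun _ => le_of_lt)
  obtain ⟨b, hbtend⟩ := exists_tendsto_of_abs_le U (φ := fun w => (f.comp (M w)).b)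
    (C := √2 * (2 * m)) (by
      filter_upwards [hlow, hup] with w h1 h2
      refine (hMb w (abs_pos.1 (by linarith))).trans (by gcongr))
  have ham : |a| = m := tendsto_nhds_unique hatend.abs hUm
  have ha0 : a ≠ 0 := abs_pos.1 (ham ▸ hm0)
  -- The third coefficient is forced by the discriminant, so it converges as soon as the other two
  -- do and `a ≠ 0`.
  set g : BinForm := ⟨a, b, (b ^ 2 - f.disc) / (4 * a)⟩ with hg
  have hgd : g.disc = f.disc := by
    simp only [hg, BinForm.disc]; field_simp; ring
  have hctend : Filter.Tendsto (fun w => (f.comp (M w)).c) U (nhds g.c) := by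
    have : Filter.Tendsto
        (fun w : cuspOrbit (heckeGroup 4) =>
          ((f.comp (M w)).b ^ 2 - f.disc) / (4 * f.eval (w : Fin 2 → ℝ))) U (nhds g.c) :=
      ((hbtend.pow 2).sub_const _).div (hatend.const_mul 4) (by simpa using ha0)
    refine this.congr' ?_
    filter_upwards [hlow] with w h1
    have h2 : f.eval (w : Fin 2 → ℝ) ≠ 0 := abs_pos.1 (by linarith)
    rw [← f.disc_comp (M w), BinForm.disc, ha]
    field_simp
    ring
  have hev : ∀ v : Fin 2 → ℝ, Filter.Tendsto
      (fun w => f.eval ((M w : Matrix (Fin 2) (Fin 2) ℝ) *ᵥ v)) U (nhds (g.eval v)) := by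
    intro v
    have : (fun w : cuspOrbit (heckeGroup 4) => f.eval ((M w : Matrix (Fin 2) (Fin 2) ℝ) *ᵥ v)) =
        fun w : cuspOrbit (heckeGroup 4) =>
        f.eval (w : Fin 2 → ℝ) * v 0 ^ 2 + (f.comp (M w)).b * v 0 * v 1 +
          (f.comp (M w)).c * v 1 ^ 2 := by
      funext w
      rw [← BinForm.eval_comp, BinForm.eval, ha]
    rw [this]
    exact (((hatend.mul_const _).add ((hbtend.mul_const _).mul_const _))).add
      (hctend.mul_const _)
  have hge : ∀ v ∈ cuspOrbit (heckeGroup 4), m ≤ |g.eval v| := by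
    intro v hv
    by_contra! hlt
    set m' := (|g.eval v| + m) / 2 with hm'
    have hm'0 : 0 < m' := by positivity
    have hA := finite_of_lt_of_lagrangeValue hf (s := √f.disc / m') ht0 h (by
      rw [lt_div_iff₀ hm'0]
      have : √f.disc = t * m := by rw [hm]; field_simp
      rw [this]; gcongr; linarith)
    have h1 : ∀ᶠ w : cuspOrbit (heckeGroup 4) in U, |f.eval ((M w : Matrix (Fin 2) (Fin 2) ℝ) *ᵥ v)| < m' :=
      (hev v).abs.eventually_lt_const (by linarith)
    -- Here `u` stands for `M w` applied to `v`, one of finitely many vectors; its determinant with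
    -- `w` is `v 1`, so each `u` leaves only finitely many `w`, and `U` contains the complement.
    have hfin := hA.biUnion (t := fun u => {w : cuspOrbit (heckeGroup 4) |
        (w : Fin 2 → ℝ) 0 * (u : Fin 2 → ℝ) 1 - (w : Fin 2 → ℝ) 1 * (u : Fin 2 → ℝ) 0 = v 1 ∧
        |f.eval (w : Fin 2 → ℝ)| ≤ 2 * m}) fun u _ =>
      ((finite_of_det_eq hf u.2 (v 1) (2 * m)).preimage Subtype.val_injective.injOn).subset
        fun w hw => ⟨w.2, hw⟩
    have h2 := hUc hfin.compl_mem_cofinite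
    obtain ⟨w, hw1, hw2, hw3⟩ := (h1.and (hup.and h2)).exists
    refine hw3 (Set.mem_biUnion
      (show (⟨_, mulVec_mem_cuspOrbit (hMG w) hv⟩ : cuspOrbit (heckeGroup 4)) ∈ _ from ?_) ⟨?_, hw2.le⟩)
    · rw [Set.mem_ofPred_eq, div_mul_eq_mul_div, div_lt_iff₀ hm'0, mul_lt_mul_iff_right₀ hd]
      exact hw1
    · rw [← hMw w]; exact det_mulVec _ _
  refine ⟨g, hgd ▸ hf, ?_⟩
  have hinf : ⨅ M : heckeGroup 4, ENNReal.ofReal |g.eval (firstCol (M : SL(2, ℝ)))| =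
      ENNReal.ofReal m := by
    apply le_antisymm
    · refine (iInf_le _ 1).trans_eq ?_
      rw [← ham]
      simp [firstCol, BinForm.eval, hg]
    · exact le_iInf fun N => ENNReal.ofReal_le_ofReal (hge _ ⟨N, N.2, rfl⟩)
  rw [markoffValue, hinf, hgd, ← ENNReal.ofReal_div_of_pos hm0, hm]
  congr 1
  field_simp

/-! ### Digit expansions and the Cantor set of admissible words -/

/-- The three ways a geodesic can leave an ideal square of the tessellation attached to `H₄`. -/
inductive Digit
  | L | M | R
  deriving DecidableEq

instance : Fintype Digit := ⟨{.L, .M, .R}, fun x => by cases x <;> simp⟩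

/-- The Möbius transformations attached to the digits, in the coordinate in which the parabolic
generator is `z ↦ z + 1`. -/
noncomputable def Digit.act : Digit → ℝ → ℝ
  | .L, z => z / (1 + 2 * z)
  | .M, z => (2 * z + 1) / (2 * z + 2)
  | .R, z => z + 1

/-- What has to be remembered of a word in order to avoid `LLL` and `RRR`. -/
inductive Mem
  | F | R1 | R2 | L1 | L2
  deriving DecidableEq

instance : Fintype Mem := ⟨{.F, .R1, .R2, .L1, .L2}, fun x => by cases x <;> simp⟩

/-- The transitions of the automaton that recognizes the words avoiding `LLL` and `RRR`. -/
def Mem.next : Mem → Digit → Option Mem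
  | _, .M => some .F
  | .L2, .L => none
  | .L1, .L => some .L2
  | _, .L => some .L1
  | .R2, .R => none
  | .R1, .R => some .R2
  | _, .R => some .R1

/-- The smallest value of an admissible expansion. -/
noncomputable def Mem.lo : Mem → ℝ
  | .L1 => √14 / 14
  | .L2 => (2 + √14) / 10
  | _ => (√14 - 2) / 10

/-- The largest value of an admissible expansion. -/
noncomputable def Mem.hi : Mem → ℝ
  | .R1 => √14 / 2
  | .R2 => √14 / 2 - 1
  | _ => 1 + √14 / 2

theorem sqrt14_mul_self : √(14 : ℝ) * √14 = 14 := Real.mul_self_sqrt (by norm_num)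

theorem sqrt14_gt : (3.7416 : ℝ) < √14 := Real.lt_sqrt_of_sq_lt (by norm_num)

theorem sqrt14_lt : √(14 : ℝ) < 3.7417 := (Real.sqrt_lt' (by norm_num)).2 (by norm_num)

theorem Mem.lo_pos (τ : Mem) : 0 < τ.lo := by
  have := sqrt14_gt
  cases τ <;> simp only [Mem.lo] <;> linarith

theorem Mem.lo_lt_hi (τ : Mem) : τ.lo < τ.hi := by
  have := sqrt14_gt
  cases τ <;> simp only [Mem.lo, Mem.hi] <;> linarith

theorem Digit.act_pos (D : Digit) {z : ℝ} (hz : 0 < z) : 0 < D.act z := by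
  cases D <;> simp only [Digit.act] <;> positivity

theorem Digit.act_strictMonoOn (D : Digit) : StrictMonoOn D.act (Set.Ici 0) := by
  intro x hx y hy hxy
  have hx : 0 ≤ x := hx
  have hy : 0 ≤ y := hy
  cases D <;> simp only [Digit.act]
  · rw [div_lt_div_iff₀ (by positivity) (by positivity)]; nlinarith
  · rw [div_lt_div_iff₀ (by positivity) (by positivity)]; nlinarith
  · linarith

theorem Digit.continuousOn_act (D : Digit) : ContinuousOn D.act (Set.Ici 0) := by
  cases D
  · change ContinuousOn (fun z : ℝ => z / (1 + 2 * z)) _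
    refine ContinuousOn.div (by fun_prop) (by fun_prop) fun x hx => ?_
    have hx : 0 ≤ x := hx
    positivity
  · change ContinuousOn (fun z : ℝ => (2 * z + 1) / (2 * z + 2)) _
    refine ContinuousOn.div (by fun_prop) (by fun_prop) fun x hx => ?_
    have hx : 0 ≤ x := hx
    positivity
  · change ContinuousOn (fun z : ℝ => z + 1) _
    fun_prop

/-- The three images of `(0, ∞)` are separated by the points `1/2` and `1`. -/
theorem Digit.act_inj {D D' : Digit} {z z' : ℝ} (hz : 0 < z) (hz' : 0 < z')
    (h : D.act z = D'.act z') : D = D' ∧ z = z' := by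
  have hL : ∀ x : ℝ, 0 < x → Digit.L.act x < 1 / 2 := fun x hx => by
    simp only [Digit.act]; rw [div_lt_div_iff₀ (by positivity) (by positivity)]; linarith
  have hM : ∀ x : ℝ, 0 < x → 1 / 2 < Digit.M.act x := fun x hx => by
    simp only [Digit.act]; rw [div_lt_div_iff₀ (by positivity) (by positivity)]; linarith
  have hM' : ∀ x : ℝ, 0 < x → Digit.M.act x < 1 := fun x hx => by
    simp only [Digit.act]; rw [div_lt_one (by positivity)]; linarith
  have hR : ∀ x : ℝ, 0 < x → 1 < Digit.R.act x := fun x hx => by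
    simp only [Digit.act]; linarith
  have hD : D = D' := by
    cases D <;> cases D' <;> first | rfl | exfalso
    · linarith [hL z hz, hM z' hz']
    · linarith [hL z hz, hR z' hz']
    · linarith [hL z' hz', hM z hz]
    · linarith [hM' z hz, hR z' hz']
    · linarith [hL z' hz', hR z hz]
    · linarith [hM' z' hz', hR z hz]
  subst hD
  exact ⟨rfl, D.act_strictMonoOn.injOn hz.le hz'.le h⟩

/-- The extreme admissible numbers are periodic: the smallest is `LLM LLM …`, the largest `RRM RRM
…`. The endpoints `Mem.lo` and `Mem.hi` lie on these two cycles, and this identity and the following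
ones are the steps of the cycles, together with the other ends of the images. -/
theorem actL_lo_L1 : Digit.L.act (√14 / 14) = (√14 - 2) / 10 := by
  have := sqrt14_mul_self
  have := sqrt14_gt
  simp only [Digit.act]; field_simp; nlinarith

theorem actL_lo_L2 : Digit.L.act ((2 + √14) / 10) = √14 / 14 := by
  have := sqrt14_mul_self
  have := sqrt14_gt
  simp only [Digit.act]; field_simp; nlinarith

theorem actL_hi : Digit.L.act (1 + √14 / 2) = (8 - √14) / 10 := by
  have := sqrt14_mul_self
  have := sqrt14_gt
  simp only [Digit.act]; field_simp; nlinarith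

theorem actM_lo : Digit.M.act ((√14 - 2) / 10) = (2 + √14) / 10 := by
  have := sqrt14_mul_self
  have := sqrt14_gt
  have h : 2 * ((√14 - 2) / 10) + 2 ≠ 0 := by linarith
  simp only [Digit.act]; rw [div_eq_div_iff h (by norm_num)]; nlinarith

theorem actM_hi : Digit.M.act (1 + √14 / 2) = √14 / 2 - 1 := by
  have := sqrt14_mul_self
  have := sqrt14_gt
  simp only [Digit.act]; field_simp; nlinarith

theorem actR (z : ℝ) : Digit.R.act z = z + 1 := rfl

theorem Mem.act_bounds {τ τ' : Mem} {D : Digit} (h : τ.next D = some τ') :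
    τ.lo ≤ D.act τ'.lo ∧ D.act τ'.hi ≤ τ.hi := by
  have := sqrt14_gt
  have := sqrt14_lt
  cases τ <;> cases D <;> simp only [Mem.next, Option.some.injEq, reduceCtorEq] at h <;>
    subst h <;> simp only [Mem.lo, Mem.hi, actL_lo_L1, actL_lo_L2, actL_hi, actM_lo, actM_hi,
      actR] <;>
    constructor <;> linarith

/-- The numbers that admit `n` digits of an admissible expansion from the state `τ`. -/
def approx : ℕ → Mem → Set ℝ
  | 0, τ => Set.Icc τ.lo τ.hi
  | n + 1, τ => ⋃ p : {p : Digit × Mem // τ.next p.1 = some p.2}, p.1.1.act '' approx n p.1.2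

theorem mem_approx_succ {n : ℕ} {τ : Mem} {x : ℝ} :
    x ∈ approx (n + 1) τ ↔ ∃ D τ', τ.next D = some τ' ∧ ∃ z ∈ approx n τ', D.act z = x := by
  simp [approx, Set.mem_iUnion]

theorem approx_subset_Icc (n : ℕ) (τ : Mem) : approx n τ ⊆ Set.Icc τ.lo τ.hi := by
  induction n generalizing τ with
  | zero => exact subset_rfl
  | succ n ih =>
    intro x hx
    obtain ⟨D, τ', h, z, hz, rfl⟩ := mem_approx_succ.1 hx
    have hz' := ih τ' hz
    have h0 := τ'.lo_pos
    have hb := Mem.act_bounds h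
    have hz0 : 0 ≤ z := h0.le.trans hz'.1
    exact ⟨hb.1.trans (D.act_strictMonoOn.monotoneOn h0.le hz0 hz'.1),
      (D.act_strictMonoOn.monotoneOn hz0 (hz0.trans hz'.2) hz'.2).trans hb.2⟩

theorem approx_pos {n : ℕ} {τ : Mem} {x : ℝ} (h : x ∈ approx n τ) : 0 < x :=
  τ.lo_pos.trans_le (approx_subset_Icc n τ h).1

theorem isCompact_approx (n : ℕ) (τ : Mem) : IsCompact (approx n τ) := by
  induction n generalizing τ with
  | zero => exact isCompact_Icc
  | succ n ih =>
    exact isCompact_iUnion fun p => (ih _).image_of_continuousOn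
      (p.1.1.continuousOn_act.mono fun x hx => (approx_pos hx).le)

theorem approx_succ_subset (n : ℕ) (τ : Mem) : approx (n + 1) τ ⊆ approx n τ := by
  induction n generalizing τ with
  | zero => exact approx_subset_Icc 1 τ
  | succ n ih =>
    intro x hx
    obtain ⟨D, τ', h, z, hz, rfl⟩ := mem_approx_succ.1 hx
    exact mem_approx_succ.2 ⟨D, τ', h, z, ih τ' hz, rfl⟩

theorem approx_antitone (τ : Mem) : Antitone fun n => approx n τ :=
  antitone_nat_of_succ_le fun n => approx_succ_subset n τ

/-- The first digit and the tail are determined by `x`, so the same tail serves all levels. -/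
theorem exists_digit {τ : Mem} {x : ℝ} (h : ∀ n, x ∈ approx n τ) :
    ∃ D τ' y, τ.next D = some τ' ∧ (∀ n, y ∈ approx n τ') ∧ D.act y = x := by
  obtain ⟨D, τ', hD, y, hy, hx⟩ := mem_approx_succ.1 (h 1)
  refine ⟨D, τ', y, hD, fun n => ?_, hx⟩
  obtain ⟨D', τ'', hD', z, hz, hx'⟩ := mem_approx_succ.1 (h (n + 1))
  obtain ⟨rfl, rfl⟩ := Digit.act_inj (approx_pos hz) (approx_pos hy) (hx'.trans hx.symm)
  rw [hD, Option.some.injEq] at hD'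
  exact hD' ▸ hz

/-- An infinite expansion of `x`, with tails `X n`, that avoids `LLL` and `RRR` and does not start
with `R`. -/
structure Expansion (x : ℝ) (D : ℕ → Digit) (X : ℕ → ℝ) : Prop where
  zero : X 0 = x
  pos : ∀ n, 0 < X n
  act : ∀ n, X n = (D n).act (X (n + 1))
  first : D 0 ≠ .R
  noL : ∀ n, ¬ (D n = .L ∧ D (n + 1) = .L ∧ D (n + 2) = .L)
  noR : ∀ n, ¬ (D n = .R ∧ D (n + 1) = .R ∧ D (n + 2) = .R)

theorem exists_expansion {x : ℝ} (h : ∀ n, x ∈ approx n .R2) : ∃ D X, Expansion x D X := by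
  have key : ∀ s : {s : Mem × ℝ // ∀ n, s.2 ∈ approx n s.1},
      ∃ (D : Digit) (s' : {s : Mem × ℝ // ∀ n, s.2 ∈ approx n s.1}),
        s.1.1.next D = some s'.1.1 ∧ D.act s'.1.2 = s.1.2 := by
    rintro ⟨⟨τ, x⟩, hx⟩
    obtain ⟨D, τ', y, h1, h2, h3⟩ := exists_digit hx
    exact ⟨D, ⟨(τ', y), h2⟩, h1, h3⟩
  choose D nx hnext hact using key
  let s : ℕ → {s : Mem × ℝ // ∀ n, s.2 ∈ approx n s.1} :=
    fun n => nx^[n] ⟨(.R2, x), h⟩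
  have hs : ∀ n, s (n + 1) = nx (s n) := fun n => Function.iterate_succ_apply' nx n _
  have hstep : ∀ n, (s n).1.1.next (D (s n)) = some (s (n + 1)).1.1 := fun n => by
    rw [hs]; exact hnext _
  refine ⟨fun n => D (s n), fun n => (s n).1.2, rfl, fun n => approx_pos ((s n).2 0),
    fun n => by rw [hs]; exact (hact _).symm, fun h0 => ?_, fun n hn => ?_, fun n hn => ?_⟩
  -- The state `R2` behaves as if `RR` had just been read, which forbids `R` as first digit.
  · have := hstep 0
    rw [h0] at this
    exact absurd this (by simp [s, Mem.next])
  · have h1 := hstep n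
    have h2 := hstep (n + 1)
    have h3 := hstep (n + 2)
    rw [hn.1] at h1; rw [hn.2.1] at h2; rw [hn.2.2] at h3
    revert h1 h2 h3
    generalize (s n).1.1 = a
    generalize (s (n + 1)).1.1 = b
    generalize (s (n + 1 + 1)).1.1 = c
    generalize (s (n + 2 + 1)).1.1 = d
    revert a b c d
    decide
  · have h1 := hstep n
    have h2 := hstep (n + 1)
    have h3 := hstep (n + 2)
    rw [hn.1] at h1; rw [hn.2.1] at h2; rw [hn.2.2] at h3
    revert h1 h2 h3
    generalize (s n).1.1 = a
    generalize (s (n + 1)).1.1 = b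
    generalize (s (n + 1 + 1)).1.1 = c
    generalize (s (n + 2 + 1)).1.1 = d
    revert a b c d
    decide

/-! ### Distortion and the comparison of gaps with pieces -/

/-- A Möbius transformation `z ↦ (a z + b) / (c z + d)` with the length of the word it comes from
and the state of the automaton after that word. -/
structure Node where
  n : ℕ
  τ : Mem
  a : ℝ
  b : ℝ
  c : ℝ
  d : ℝ

namespace Node

/-- The Möbius transformation of the node. -/
noncomputable def map (N : Node) (z : ℝ) : ℝ := (N.a * z + N.b) / (N.c * z + N.d)

/-- The node obtained by appending a digit. -/
def child (N : Node) : Digit → Mem → Node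
  | .L, τ => ⟨N.n + 1, τ, N.a + 2 * N.b, N.b, N.c + 2 * N.d, N.d⟩
  | .M, τ => ⟨N.n + 1, τ, 2 * N.a + 2 * N.b, N.a + 2 * N.b, 2 * N.c + 2 * N.d, N.c + 2 * N.d⟩
  | .R, τ => ⟨N.n + 1, τ, N.a, N.a + N.b, N.c, N.c + N.d⟩

/-- The possible positions of the pole `-d / c`. -/
def Cone : Mem → ℝ → ℝ → Prop
  | .F, c, d => d ≤ c ∧ c ≤ 2 * d
  | .R1, c, d => c ≤ d ∧ d ≤ 2 * c
  | .R2, c, d => 2 * c ≤ d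
  | .L1, c, d => 2 * d ≤ c ∧ c ≤ 4 * d
  | .L2, c, d => 4 * d ≤ c

/-- The node comes from an admissible word. -/
structure Valid (N : Node) : Prop where
  c_nonneg : 0 ≤ N.c
  d_nonneg : 0 ≤ N.d
  pos : 0 < N.c + N.d
  det : 0 < N.a * N.d - N.b * N.c
  cone : Cone N.τ N.c N.d
  mem : ∀ m, ∀ z ∈ approx m N.τ, N.map z ∈ approx (N.n + m) .R2

theorem Valid.den_pos {N : Node} (h : N.Valid) {z : ℝ} (hz : 0 < z) : 0 < N.c * z + N.d := by
  have h1 := h.c_nonneg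
  have h2 := h.d_nonneg
  rcases h1.eq_or_lt with h3 | h3
  · have := h.pos
    rw [← h3] at this ⊢
    linarith
  · positivity

theorem map_child (N : Node) (D : Digit) (τ : Mem) {z : ℝ} (hz : 0 < z) :
    (N.child D τ).map z = N.map (D.act z) := by
  cases D <;> simp only [map, child, Digit.act]
  · have h2 : 1 + 2 * z ≠ 0 := by positivity
    have key : ∀ x y : ℝ, (x + 2 * y) * z + y = (x * (z / (1 + 2 * z)) + y) * (1 + 2 * z) :=
      fun x y => by field_simp; ring
    rw [key, key, mul_div_mul_right _ _ h2]
  · have h2 : 2 * z + 2 ≠ 0 := by positivity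
    have key : ∀ x y : ℝ, (2 * x + 2 * y) * z + (x + 2 * y) =
        (x * ((2 * z + 1) / (2 * z + 2)) + y) * (2 * z + 2) := fun x y => by field_simp; ring
    rw [key, key, mul_div_mul_right _ _ h2]
  · congr 1 <;> ring

/-- Appending a digit transforms `d / c` by the same digit map, so `Cone` records only the interval
to which the last digits confine `d / c`. -/
theorem Valid.child {N : Node} (h : N.Valid) {D : Digit} {τ : Mem} (hD : N.τ.next D = some τ) :
    (N.child D τ).Valid := by
  have hc := h.c_nonneg
  have hd := h.d_nonneg
  have hp := h.pos
  have hdet := h.det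
  have hcone := h.cone
  refine ⟨?_, ?_, ?_, ?_, ?_, ?_⟩
  · cases D <;> simp only [Node.child] <;> positivity
  · cases D <;> simp only [Node.child] <;> positivity
  · cases D <;> simp only [Node.child] <;> linarith
  · cases D <;> simp only [Node.child] <;> linarith
  · revert hcone hD
    generalize N.τ = σ
    intro hD hcone
    cases σ <;> cases D <;> simp only [Mem.next, Option.some.injEq, reduceCtorEq] at hD <;>
      subst hD <;> simp only [Cone, Node.child] at hcone ⊢ <;>
      first | (constructor <;> linarith) | linarith
  · intro m z hz
    have hz0 := approx_pos hz
    have h1 : (N.child D τ).τ = τ := by cases D <;> rfl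
    have h2 : (N.child D τ).n = N.n + 1 := by cases D <;> rfl
    rw [h1] at hz
    rw [map_child N D τ hz0, h2, show N.n + 1 + m = N.n + (m + 1) by ring]
    exact h.mem _ _ (mem_approx_succ.2 ⟨D, τ, hD, z, hz, rfl⟩)

theorem map_sub_map {N : Node} (h : N.Valid) {p q : ℝ} (hp : 0 < p) (hq : 0 < q) :
    N.map q - N.map p =
      (N.a * N.d - N.b * N.c) * ((q - p) / ((N.c * p + N.d) * (N.c * q + N.d))) := by
  have h1 := h.den_pos hp
  have h2 := h.den_pos hq
  rw [map, map, div_sub_div _ _ h2.ne' h1.ne', ← mul_div_assoc]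
  congr 1 <;> ring

theorem map_strictMonoOn {N : Node} (h : N.Valid) : StrictMonoOn N.map (Set.Ioi 0) := by
  intro p hp q hq hpq
  have h1 := h.den_pos hp
  have h2 := h.den_pos hq
  have h3 := h.det
  rw [← sub_pos, map_sub_map h hp hq]
  have := sub_pos.2 hpq
  positivity

/-- The determinant cancels in a ratio of two image lengths, which leaves a polynomial inequality in
`c` and `d` alone. -/
theorem map_sub_le {N : Node} (h : N.Valid) {p q u v k : ℝ} (hp : 0 < p) (hq : 0 < q)
    (hu : 0 < u) (hv : 0 < v)
    (hk : (q - p) * ((N.c * u + N.d) * (N.c * v + N.d)) ≤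
      k * (v - u) * ((N.c * p + N.d) * (N.c * q + N.d))) :
    N.map q - N.map p ≤ k * (N.map v - N.map u) := by
  have h1 := h.den_pos hp
  have h2 := h.den_pos hq
  have h3 := h.den_pos hu
  have h4 := h.den_pos hv
  rw [map_sub_map h hp hq, map_sub_map h hu hv, mul_left_comm]
  refine mul_le_mul_of_nonneg_left ?_ h.det.le
  rw [← mul_div_assoc, div_le_div_iff₀ (by positivity) (by positivity)]
  exact hk

theorem le_map_sub {N : Node} (h : N.Valid) {p q u v k : ℝ} (hp : 0 < p) (hq : 0 < q)
    (hu : 0 < u) (hv : 0 < v)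
    (hk : k * (v - u) * ((N.c * p + N.d) * (N.c * q + N.d)) ≤
      (q - p) * ((N.c * u + N.d) * (N.c * v + N.d))) :
    k * (N.map v - N.map u) ≤ N.map q - N.map p := by
  have h1 := h.den_pos hp
  have h2 := h.den_pos hq
  have h3 := h.den_pos hu
  have h4 := h.den_pos hv
  rw [map_sub_map h hp hq, map_sub_map h hu hv, mul_left_comm]
  refine mul_le_mul_of_nonneg_left ?_ h.det.le
  rw [← mul_div_assoc, div_le_div_iff₀ (by positivity) (by positivity)]
  exact hk

/-- The length of the interval of a node. -/
noncomputable def len (N : Node) : ℝ := N.map N.τ.hi - N.map N.τ.lo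

end Node

/-- Relative to the length of an interval in the given state, an upper bound for the gaps and a
lower bound for the children. -/
noncomputable def Mem.ratio : Mem → ℝ
  | .F => 16 / 100
  | .R1 | .L1 => 18 / 100
  | .R2 | .L2 => 23 / 100

/-- Three pieces separated by two gaps: `[s, s + l]` is at least as long as each gap, so it cannot
lie strictly inside one. As the other two pieces each take at least the fraction `k`, a piece has at
most the fraction `1 - 2k`; this gives the bounds by `k₁`, `k₂`, `k₃` and the factor `84/100 = 1 -
16/100`. -/
theorem split_three {A₀ A₁ A₂ A₃ A₄ A₅ k k₁ k₂ k₃ s l : ℝ}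
    (hk : 16 / 100 ≤ k) (hk₁ : 0 ≤ k₁) (hk₂ : 0 ≤ k₂) (hk₃ : 0 ≤ k₃)
    (hkk₁ : k₁ * (1 - 2 * k) ≤ k) (hkk₂ : k₂ * (1 - 2 * k) ≤ k) (hkk₃ : k₃ * (1 - 2 * k) ≤ k)
    (h₁ : k * (A₅ - A₀) ≤ A₁ - A₀) (h₂ : k * (A₅ - A₀) ≤ A₃ - A₂)
    (h₃ : k * (A₅ - A₀) ≤ A₅ - A₄) (hg : A₂ - A₁ ≤ k * (A₅ - A₀)) (hg' : A₄ - A₃ ≤ k * (A₅ - A₀))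
    (h12 : A₁ ≤ A₂) (h34 : A₃ ≤ A₄) (h05 : A₀ < A₅)
    (hs : A₀ ≤ s + l) (hs' : s ≤ A₅) (hl : k * (A₅ - A₀) ≤ l) :
    (A₀ ≤ s + l ∧ s ≤ A₁ ∧ k * (A₅ - A₀) ≤ A₁ - A₀ ∧ k₁ * (A₁ - A₀) ≤ k * (A₅ - A₀) ∧
      A₁ - A₀ ≤ 84 / 100 * (A₅ - A₀)) ∨
    (A₂ ≤ s + l ∧ s ≤ A₃ ∧ k * (A₅ - A₀) ≤ A₃ - A₂ ∧ k₂ * (A₃ - A₂) ≤ k * (A₅ - A₀) ∧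
      A₃ - A₂ ≤ 84 / 100 * (A₅ - A₀)) ∨
    (A₄ ≤ s + l ∧ s ≤ A₅ ∧ k * (A₅ - A₀) ≤ A₅ - A₄ ∧ k₃ * (A₅ - A₄) ≤ k * (A₅ - A₀) ∧
      A₅ - A₄ ≤ 84 / 100 * (A₅ - A₀)) := by
  have hX : 0 ≤ A₅ - A₀ := by linarith
  have hb : ∀ x k', 0 ≤ k' → k' * (1 - 2 * k) ≤ k → x ≤ (1 - 2 * k) * (A₅ - A₀) →
      k' * x ≤ k * (A₅ - A₀) ∧ x ≤ 84 / 100 * (A₅ - A₀) := by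
    intro x k' h0 hk' hx
    refine ⟨?_, hx.trans (mul_le_mul_of_nonneg_right (by linarith) hX)⟩
    calc k' * x ≤ k' * ((1 - 2 * k) * (A₅ - A₀)) := mul_le_mul_of_nonneg_left hx h0
      _ = k' * (1 - 2 * k) * (A₅ - A₀) := by ring
      _ ≤ _ := mul_le_mul_of_nonneg_right hk' hX
  by_cases h : s ≤ A₁
  · exact Or.inl ⟨hs, h, h₁, hb _ _ hk₁ hkk₁ (by linarith)⟩
  by_cases h' : s ≤ A₃
  · exact Or.inr (Or.inl ⟨by linarith, h', h₂, hb _ _ hk₂ hkk₂ (by linarith)⟩)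
  · exact Or.inr (Or.inr ⟨by linarith, hs', h₃, hb _ _ hk₃ hkk₃ (by linarith)⟩)

theorem split_two {A₀ A₁ A₂ A₃ k k₁ k₂ s l : ℝ}
    (hk : 16 / 100 ≤ k) (hk₁ : 0 ≤ k₁) (hk₂ : 0 ≤ k₂)
    (hkk₁ : k₁ * (1 - k) ≤ k) (hkk₂ : k₂ * (1 - k) ≤ k)
    (h₁ : k * (A₃ - A₀) ≤ A₁ - A₀) (h₂ : k * (A₃ - A₀) ≤ A₃ - A₂)
    (hg : A₂ - A₁ ≤ k * (A₃ - A₀)) (h12 : A₁ ≤ A₂) (h03 : A₀ < A₃)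
    (hs : A₀ ≤ s + l) (hs' : s ≤ A₃) (hl : k * (A₃ - A₀) ≤ l) :
    (A₀ ≤ s + l ∧ s ≤ A₁ ∧ k * (A₃ - A₀) ≤ A₁ - A₀ ∧ k₁ * (A₁ - A₀) ≤ k * (A₃ - A₀) ∧
      A₁ - A₀ ≤ 84 / 100 * (A₃ - A₀)) ∨
    (A₂ ≤ s + l ∧ s ≤ A₃ ∧ k * (A₃ - A₀) ≤ A₃ - A₂ ∧ k₂ * (A₃ - A₂) ≤ k * (A₃ - A₀) ∧
      A₃ - A₂ ≤ 84 / 100 * (A₃ - A₀)) := by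
  have hX : 0 ≤ A₃ - A₀ := by linarith
  have hb : ∀ x k', 0 ≤ k' → k' * (1 - k) ≤ k → x ≤ (1 - k) * (A₃ - A₀) →
      k' * x ≤ k * (A₃ - A₀) ∧ x ≤ 84 / 100 * (A₃ - A₀) := by
    intro x k' h0 hk' hx
    refine ⟨?_, hx.trans (mul_le_mul_of_nonneg_right (by linarith) hX)⟩
    calc k' * x ≤ k' * ((1 - k) * (A₃ - A₀)) := mul_le_mul_of_nonneg_left hx h0
      _ = k' * (1 - k) * (A₃ - A₀) := by ring
      _ ≤ _ := mul_le_mul_of_nonneg_right hk' hX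
  by_cases h : s ≤ A₁
  · exact Or.inl ⟨hs, h, h₁, hb _ _ hk₁ hkk₁ (by linarith)⟩
  · exact Or.inr ⟨by linarith, hs', h₂, hb _ _ hk₂ hkk₂ (by linarith)⟩

/-- Together with `mul_sq_sqrt14` this supplies the products from which `linarith` proves
inequalities quadratic in `c, d` with coefficients involving `√14`. -/
theorem prod_sqrt14_bounds {r X : ℝ} (h1 : 3.7416 < r) (h2 : r < 3.7417) (hX : 0 ≤ X) :
    0 ≤ X * (r - 3.7416) ∧ 0 ≤ X * (3.7417 - r) :=
  ⟨mul_nonneg hX (by linarith), mul_nonneg hX (by linarith)⟩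

theorem mul_sq_sqrt14 {r : ℝ} (hr : r * r = 14) (c d : ℝ) :
    (c * c * (r * r) = c * c * 14 ∧ c * d * (r * r) = c * d * 14 ∧ d * d * (r * r) = d * d * 14) ∧
      c * c * r * (r * r) = c * c * r * 14 ∧ c * d * r * (r * r) = c * d * r * 14 ∧
        d * d * r * (r * r) = d * d * r * 14 := by
  simp only [hr, and_self]

/-- If an interval `[s, s + l]` that is not too short meets the interval of a node, then it meets the
interval of a child, with bounds for the length of this child. -/
def Node.Splits (N : Node) : Prop :=
  ∀ s l : ℝ, N.map N.τ.lo ≤ s + l → s ≤ N.map N.τ.hi → N.τ.ratio * N.len ≤ l →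
    ∃ D τ', N.τ.next D = some τ' ∧
      N.map (D.act τ'.lo) ≤ s + l ∧ s ≤ N.map (D.act τ'.hi) ∧
      N.τ.ratio * N.len ≤ N.map (D.act τ'.hi) - N.map (D.act τ'.lo) ∧
      τ'.ratio * (N.map (D.act τ'.hi) - N.map (D.act τ'.lo)) ≤ N.τ.ratio * N.len ∧
      N.map (D.act τ'.hi) - N.map (D.act τ'.lo) ≤ 84 / 100 * N.len

/-- Comparing gaps and children with the whole interval amounts to quadratic inequalities in `c, d`
on the cone of the state. They follow from the products `t1`, `t2`, `t3` of the cone inequalities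
and decimal bounds for `√14`. The same scheme serves the other four states. -/
theorem Node.Valid.splits_F {N : Node} (h : N.Valid) (hτ : N.τ = .F) : N.Splits := by
  intro s l hs hs' hl
  have hr := sqrt14_mul_self
  have hr1 := sqrt14_gt
  have hr2 := sqrt14_lt
  have hc := h.c_nonneg
  have hd := h.d_nonneg
  have hcone := h.cone
  have hmono := Node.map_strictMonoOn h
  rw [Node.len, hτ] at *
  simp only [Mem.lo, Mem.hi, Mem.ratio, Node.Cone] at hs hs' hl hcone ⊢
  have t1 := mul_nonneg (sub_nonneg.2 hcone.1) (sub_nonneg.2 hcone.1)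
  have t2 := mul_nonneg (sub_nonneg.2 hcone.1) (sub_nonneg.2 hcone.2)
  have t3 := mul_nonneg (sub_nonneg.2 hcone.2) (sub_nonneg.2 hcone.2)
  obtain ⟨u1, v1⟩ := prod_sqrt14_bounds hr1 hr2 t1
  obtain ⟨u2, v2⟩ := prod_sqrt14_bounds hr1 hr2 t2
  obtain ⟨u3, v3⟩ := prod_sqrt14_bounds hr1 hr2 t3
  have e := mul_sq_sqrt14 hr N.c N.d
  have q0 : 0 < (√14 - 2) / 10 := by linarith
  have q1 : 0 < (8 - √14) / 10 := by linarith
  have q2 : 0 < (2 + √14) / 10 := by linarith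
  have q3 : 0 < √14 / 2 - 1 := by linarith
  have q4 : 0 < (√14 - 2) / 10 + 1 := by linarith
  have q5 : 0 < 1 + √14 / 2 := by linarith
  have H := split_three
    (A₀ := N.map ((√14 - 2) / 10)) (A₁ := N.map ((8 - √14) / 10)) (A₂ := N.map ((2 + √14) / 10))
      (A₃ := N.map (√14 / 2 - 1)) (A₄ := N.map ((√14 - 2) / 10 + 1)) (A₅ := N.map (1 + √14 / 2))
    (k := 16 / 100) (k₁ := 18 / 100) (k₂ := 16 / 100) (k₃ := 18 / 100) (s := s) (l := l)
    (by norm_num) (by norm_num) (by norm_num) (by norm_num) (by norm_num) (by norm_num) (by norm_num)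
    (Node.le_map_sub h q0 q1 q0 q5 (by linarith))
    (Node.le_map_sub h q2 q3 q0 q5 (by linarith))
    (Node.le_map_sub h q4 q5 q0 q5 (by linarith))
    (Node.map_sub_le h q1 q2 q0 q5 (by linarith))
    (Node.map_sub_le h q3 q4 q0 q5 (by linarith))
    (hmono q1 q2 (by linarith)).le (hmono q3 q4 (by linarith)).le
    (hmono q0 q5 (by linarith)) hs hs' hl
  rcases H with H | H | H
  · refine ⟨.L, .L1, rfl, ?_⟩
    simpa only [Mem.lo, Mem.hi, Mem.ratio, actL_lo_L1, actL_hi] using H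
  · refine ⟨.M, .F, rfl, ?_⟩
    simpa only [Mem.lo, Mem.hi, Mem.ratio, actM_lo, actM_hi] using H
  · refine ⟨.R, .R1, rfl, ?_⟩
    simpa only [Mem.lo, Mem.hi, Mem.ratio, actR, show √14 / 2 + 1 = 1 + √14 / 2 from add_comm _ _] using H

theorem Node.Valid.splits_R1 {N : Node} (h : N.Valid) (hτ : N.τ = .R1) : N.Splits := by
  intro s l hs hs' hl
  have hr := sqrt14_mul_self
  have hr1 := sqrt14_gt
  have hr2 := sqrt14_lt
  have hc := h.c_nonneg
  have hd := h.d_nonneg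
  have hcone := h.cone
  have hmono := Node.map_strictMonoOn h
  rw [Node.len, hτ] at *
  simp only [Mem.lo, Mem.hi, Mem.ratio, Node.Cone] at hs hs' hl hcone ⊢
  have t1 := mul_nonneg (sub_nonneg.2 hcone.1) (sub_nonneg.2 hcone.1)
  have t2 := mul_nonneg (sub_nonneg.2 hcone.1) (sub_nonneg.2 hcone.2)
  have t3 := mul_nonneg (sub_nonneg.2 hcone.2) (sub_nonneg.2 hcone.2)
  obtain ⟨u1, v1⟩ := prod_sqrt14_bounds hr1 hr2 t1
  obtain ⟨u2, v2⟩ := prod_sqrt14_bounds hr1 hr2 t2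
  obtain ⟨u3, v3⟩ := prod_sqrt14_bounds hr1 hr2 t3
  have e := mul_sq_sqrt14 hr N.c N.d
  have q0 : 0 < (√14 - 2) / 10 := by linarith
  have q1 : 0 < (8 - √14) / 10 := by linarith
  have q2 : 0 < (2 + √14) / 10 := by linarith
  have q3 : 0 < √14 / 2 - 1 := by linarith
  have q4 : 0 < (√14 - 2) / 10 + 1 := by linarith
  have q5 : 0 < √14 / 2 := by linarith
  have H := split_three
    (A₀ := N.map ((√14 - 2) / 10)) (A₁ := N.map ((8 - √14) / 10)) (A₂ := N.map ((2 + √14) / 10))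
      (A₃ := N.map (√14 / 2 - 1)) (A₄ := N.map ((√14 - 2) / 10 + 1)) (A₅ := N.map (√14 / 2))
    (k := 18 / 100) (k₁ := 18 / 100) (k₂ := 16 / 100) (k₃ := 23 / 100) (s := s) (l := l)
    (by norm_num) (by norm_num) (by norm_num) (by norm_num) (by norm_num) (by norm_num) (by norm_num)
    (Node.le_map_sub h q0 q1 q0 q5 (by linarith))
    (Node.le_map_sub h q2 q3 q0 q5 (by linarith))
    (Node.le_map_sub h q4 q5 q0 q5 (by linarith))
    (Node.map_sub_le h q1 q2 q0 q5 (by linarith))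
    (Node.map_sub_le h q3 q4 q0 q5 (by linarith))
    (hmono q1 q2 (by linarith)).le (hmono q3 q4 (by linarith)).le
    (hmono q0 q5 (by linarith)) hs hs' hl
  rcases H with H | H | H
  · refine ⟨.L, .L1, rfl, ?_⟩
    simpa only [Mem.lo, Mem.hi, Mem.ratio, actL_lo_L1, actL_hi] using H
  · refine ⟨.M, .F, rfl, ?_⟩
    simpa only [Mem.lo, Mem.hi, Mem.ratio, actM_lo, actM_hi] using H
  · refine ⟨.R, .R2, rfl, ?_⟩
    simpa only [Mem.lo, Mem.hi, Mem.ratio, actR, sub_add_cancel] using H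

theorem Node.Valid.splits_R2 {N : Node} (h : N.Valid) (hτ : N.τ = .R2) : N.Splits := by
  intro s l hs hs' hl
  have hr := sqrt14_mul_self
  have hr1 := sqrt14_gt
  have hr2 := sqrt14_lt
  have hc := h.c_nonneg
  have hd := h.d_nonneg
  have hcone := h.cone
  have hmono := Node.map_strictMonoOn h
  rw [Node.len, hτ] at *
  simp only [Mem.lo, Mem.hi, Mem.ratio, Node.Cone] at hs hs' hl hcone ⊢
  have t1 := mul_nonneg (sub_nonneg.2 hcone) (sub_nonneg.2 hcone)
  have t2 := mul_nonneg (sub_nonneg.2 hcone) hc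
  have t3 := mul_nonneg hc hc
  obtain ⟨u1, v1⟩ := prod_sqrt14_bounds hr1 hr2 t1
  obtain ⟨u2, v2⟩ := prod_sqrt14_bounds hr1 hr2 t2
  obtain ⟨u3, v3⟩ := prod_sqrt14_bounds hr1 hr2 t3
  have e := mul_sq_sqrt14 hr N.c N.d
  have q0 : 0 < (√14 - 2) / 10 := by linarith
  have q1 : 0 < (8 - √14) / 10 := by linarith
  have q2 : 0 < (2 + √14) / 10 := by linarith
  have q3 : 0 < √14 / 2 - 1 := by linarith
  have H := split_two
    (A₀ := N.map ((√14 - 2) / 10)) (A₁ := N.map ((8 - √14) / 10)) (A₂ := N.map ((2 + √14) / 10))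
      (A₃ := N.map (√14 / 2 - 1))
    (k := 23 / 100) (k₁ := 18 / 100) (k₂ := 16 / 100) (s := s) (l := l)
    (by norm_num) (by norm_num) (by norm_num) (by norm_num) (by norm_num)
    (Node.le_map_sub h q0 q1 q0 q3 (by linarith))
    (Node.le_map_sub h q2 q3 q0 q3 (by linarith))
    (Node.map_sub_le h q1 q2 q0 q3 (by linarith))
    (hmono q1 q2 (by linarith)).le
    (hmono q0 q3 (by linarith)) hs hs' hl
  rcases H with H | H
  · refine ⟨.L, .L1, rfl, ?_⟩
    simpa only [Mem.lo, Mem.hi, Mem.ratio, actL_lo_L1, actL_hi] using H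
  · refine ⟨.M, .F, rfl, ?_⟩
    simpa only [Mem.lo, Mem.hi, Mem.ratio, actM_lo, actM_hi] using H

theorem Node.Valid.splits_L1 {N : Node} (h : N.Valid) (hτ : N.τ = .L1) : N.Splits := by
  intro s l hs hs' hl
  have hr := sqrt14_mul_self
  have hr1 := sqrt14_gt
  have hr2 := sqrt14_lt
  have hc := h.c_nonneg
  have hd := h.d_nonneg
  have hcone := h.cone
  have hmono := Node.map_strictMonoOn h
  rw [Node.len, hτ] at *
  simp only [Mem.lo, Mem.hi, Mem.ratio, Node.Cone] at hs hs' hl hcone ⊢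
  have t1 := mul_nonneg (sub_nonneg.2 hcone.1) (sub_nonneg.2 hcone.1)
  have t2 := mul_nonneg (sub_nonneg.2 hcone.1) (sub_nonneg.2 hcone.2)
  have t3 := mul_nonneg (sub_nonneg.2 hcone.2) (sub_nonneg.2 hcone.2)
  obtain ⟨u1, v1⟩ := prod_sqrt14_bounds hr1 hr2 t1
  obtain ⟨u2, v2⟩ := prod_sqrt14_bounds hr1 hr2 t2
  obtain ⟨u3, v3⟩ := prod_sqrt14_bounds hr1 hr2 t3
  have e := mul_sq_sqrt14 hr N.c N.d
  have q0 : 0 < √14 / 14 := by linarith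
  have q1 : 0 < (8 - √14) / 10 := by linarith
  have q2 : 0 < (2 + √14) / 10 := by linarith
  have q3 : 0 < √14 / 2 - 1 := by linarith
  have q4 : 0 < (√14 - 2) / 10 + 1 := by linarith
  have q5 : 0 < 1 + √14 / 2 := by linarith
  have H := split_three
    (A₀ := N.map (√14 / 14)) (A₁ := N.map ((8 - √14) / 10)) (A₂ := N.map ((2 + √14) / 10))
      (A₃ := N.map (√14 / 2 - 1)) (A₄ := N.map ((√14 - 2) / 10 + 1)) (A₅ := N.map (1 + √14 / 2))
    (k := 18 / 100) (k₁ := 23 / 100) (k₂ := 16 / 100) (k₃ := 18 / 100) (s := s) (l := l)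
    (by norm_num) (by norm_num) (by norm_num) (by norm_num) (by norm_num) (by norm_num) (by norm_num)
    (Node.le_map_sub h q0 q1 q0 q5 (by linarith))
    (Node.le_map_sub h q2 q3 q0 q5 (by linarith))
    (Node.le_map_sub h q4 q5 q0 q5 (by linarith))
    (Node.map_sub_le h q1 q2 q0 q5 (by linarith))
    (Node.map_sub_le h q3 q4 q0 q5 (by linarith))
    (hmono q1 q2 (by linarith)).le (hmono q3 q4 (by linarith)).le
    (hmono q0 q5 (by linarith)) hs hs' hl
  rcases H with H | H | H
  · refine ⟨.L, .L2, rfl, ?_⟩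
    simpa only [Mem.lo, Mem.hi, Mem.ratio, actL_lo_L2, actL_hi] using H
  · refine ⟨.M, .F, rfl, ?_⟩
    simpa only [Mem.lo, Mem.hi, Mem.ratio, actM_lo, actM_hi] using H
  · refine ⟨.R, .R1, rfl, ?_⟩
    simpa only [Mem.lo, Mem.hi, Mem.ratio, actR, show √14 / 2 + 1 = 1 + √14 / 2 from add_comm _ _] using H

theorem Node.Valid.splits_L2 {N : Node} (h : N.Valid) (hτ : N.τ = .L2) : N.Splits := by
  intro s l hs hs' hl
  have hr := sqrt14_mul_self
  have hr1 := sqrt14_gt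
  have hr2 := sqrt14_lt
  have hc := h.c_nonneg
  have hd := h.d_nonneg
  have hcone := h.cone
  have hmono := Node.map_strictMonoOn h
  rw [Node.len, hτ] at *
  simp only [Mem.lo, Mem.hi, Mem.ratio, Node.Cone] at hs hs' hl hcone ⊢
  have t1 := mul_nonneg (sub_nonneg.2 hcone) (sub_nonneg.2 hcone)
  have t2 := mul_nonneg (sub_nonneg.2 hcone) hd
  have t3 := mul_nonneg hd hd
  obtain ⟨u1, v1⟩ := prod_sqrt14_bounds hr1 hr2 t1
  obtain ⟨u2, v2⟩ := prod_sqrt14_bounds hr1 hr2 t2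
  obtain ⟨u3, v3⟩ := prod_sqrt14_bounds hr1 hr2 t3
  have e := mul_sq_sqrt14 hr N.c N.d
  have q0 : 0 < (2 + √14) / 10 := by linarith
  have q1 : 0 < √14 / 2 - 1 := by linarith
  have q2 : 0 < (√14 - 2) / 10 + 1 := by linarith
  have q3 : 0 < 1 + √14 / 2 := by linarith
  have H := split_two
    (A₀ := N.map ((2 + √14) / 10)) (A₁ := N.map (√14 / 2 - 1)) (A₂ := N.map ((√14 - 2) / 10 + 1))
      (A₃ := N.map (1 + √14 / 2))
    (k := 23 / 100) (k₁ := 16 / 100) (k₂ := 18 / 100) (s := s) (l := l)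
    (by norm_num) (by norm_num) (by norm_num) (by norm_num) (by norm_num)
    (Node.le_map_sub h q0 q1 q0 q3 (by linarith))
    (Node.le_map_sub h q2 q3 q0 q3 (by linarith))
    (Node.map_sub_le h q1 q2 q0 q3 (by linarith))
    (hmono q1 q2 (by linarith)).le
    (hmono q0 q3 (by linarith)) hs hs' hl
  rcases H with H | H
  · refine ⟨.M, .F, rfl, ?_⟩
    simpa only [Mem.lo, Mem.hi, Mem.ratio, actM_lo, actM_hi] using H
  · refine ⟨.R, .R1, rfl, ?_⟩
    simpa only [Mem.lo, Mem.hi, Mem.ratio, actR, show √14 / 2 + 1 = 1 + √14 / 2 from add_comm _ _] using H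

theorem Node.Valid.splits {N : Node} (h : N.Valid) : N.Splits := by
  cases hτ : N.τ
  · exact h.splits_F hτ
  · exact h.splits_R1 hτ
  · exact h.splits_R2 hτ
  · exact h.splits_L1 hτ
  · exact h.splits_L2 hτ

theorem Mem.ratio_ge (τ : Mem) : 16 / 100 ≤ τ.ratio := by
  cases τ <;> simp only [Mem.ratio] <;> norm_num

/-! ### The sum of the Cantor set with itself -/

namespace Node

theorem Valid.len_pos {N : Node} (h : N.Valid) : 0 < N.len :=
  sub_pos.2 (map_strictMonoOn h N.τ.lo_pos (N.τ.lo_pos.trans N.τ.lo_lt_hi) N.τ.lo_lt_hi)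

theorem child_τ (N : Node) (D : Digit) (τ : Mem) : (N.child D τ).τ = τ := by cases D <;> rfl

theorem child_n (N : Node) (D : Digit) (τ : Mem) : (N.child D τ).n = N.n + 1 := by
  cases D <;> rfl

theorem map_child_lo (N : Node) (D : Digit) (τ : Mem) :
    (N.child D τ).map (N.child D τ).τ.lo = N.map (D.act τ.lo) := by
  rw [child_τ, map_child N D τ τ.lo_pos]

theorem map_child_hi (N : Node) (D : Digit) (τ : Mem) :
    (N.child D τ).map (N.child D τ).τ.hi = N.map (D.act τ.hi) := by
  rw [child_τ, map_child N D τ (τ.lo_pos.trans τ.lo_lt_hi)]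

/-- The initial node. -/
def root : Node := ⟨0, .R2, 1, 0, 0, 1⟩

theorem root_map (z : ℝ) : root.map z = z := by simp [root, map]

theorem root_valid : root.Valid := by
  refine ⟨by simp [root], by simp [root], by simp [root], by simp [root], by simp [root, Cone], ?_⟩
  intro m z hz
  rw [root_map]
  simpa [root] using hz

/-- `t` lies in the sum of the intervals of two admissible nodes of comparable lengths. -/
structure Comparable (t : ℝ) (I J : Node) : Prop where
  left : I.Valid
  right : J.Valid
  lo_le : I.map I.τ.lo + J.map J.τ.lo ≤ t
  le_hi : t ≤ I.map I.τ.hi + J.map J.τ.hi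
  ratio_left : I.τ.ratio * I.len ≤ J.len
  ratio_right : J.τ.ratio * J.len ≤ I.len
  len_left : (16 / 100) ^ I.n * root.len ≤ I.len
  len_right : (16 / 100) ^ J.n * root.len ≤ J.len

theorem Comparable.symm {t : ℝ} {I J : Node} (h : Comparable t I J) : Comparable t J I :=
  ⟨h.right, h.left, by linarith [h.lo_le], by linarith [h.le_hi], h.ratio_right, h.ratio_left,
    h.len_right, h.len_left⟩

/-- The point `t` lies in `I + J` exactly when `t - J` meets `I`. The gaps of `I` are at most
`J.len`, so `t - J` meets a child of `I`. Splitting the interval with the larger `ratio * len` is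
what preserves `ratio_right`. -/
theorem Comparable.split_left {t : ℝ} {I J : Node} (h : Comparable t I J)
    (hIJ : J.τ.ratio * J.len ≤ I.τ.ratio * I.len) :
    ∃ I', Comparable t I' J ∧ I'.len ≤ 84 / 100 * I.len := by
  have hJ : J.len = J.map J.τ.hi - J.map J.τ.lo := rfl
  obtain ⟨D, τ, hD, h1, h2, h3, h4, h5⟩ := h.left.splits (t - J.map J.τ.hi) J.len
    (by linarith [h.lo_le]) (by linarith [h.le_hi]) h.ratio_left
  have hlen : (I.child D τ).len = I.map (D.act τ.hi) - I.map (D.act τ.lo) := by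
    rw [len, map_child_lo, map_child_hi]
  rw [← hlen] at h3 h4 h5
  refine ⟨I.child D τ, ⟨h.left.child hD, h.right, ?_, ?_, ?_, ?_, ?_, h.len_right⟩, h5⟩
  · rw [map_child_lo]; linarith
  · rw [map_child_hi]; linarith
  · rw [child_τ]; exact h4.trans h.ratio_left
  · exact hIJ.trans h3
  · rw [child_n, pow_succ']
    have := mul_le_mul_of_nonneg_right I.τ.ratio_ge h.left.len_pos.le
    linarith [h.len_left]

theorem Comparable.split {t : ℝ} {I J : Node} (h : Comparable t I J) :
    ∃ I' J', Comparable t I' J' ∧ I'.len * J'.len ≤ 84 / 100 * (I.len * J.len) := by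
  rcases le_total (J.τ.ratio * J.len) (I.τ.ratio * I.len) with hIJ | hIJ
  · obtain ⟨I', h1, h2⟩ := h.split_left hIJ
    refine ⟨I', J, h1, ?_⟩
    have := mul_le_mul_of_nonneg_right h2 h.right.len_pos.le
    linarith
  · obtain ⟨J', h1, h2⟩ := h.symm.split_left hIJ
    refine ⟨I, J', h1.symm, ?_⟩
    have := mul_le_mul_of_nonneg_left h2 h.left.len_pos.le
    linarith

/-- The lengths are comparable, so a small product makes `I` short; but a node of depth `n` has
length at least `(16/100)^n` times that of the root. -/
theorem Comparable.lt_n {t : ℝ} {I J : Node} (h : Comparable t I J) {k m : ℕ}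
    (hk : I.len * J.len ≤ (84 / 100) ^ k * root.len ^ 2)
    (hm : (84 / 100 : ℝ) ^ k < (16 / 100) ^ (2 * m + 1)) : m < I.n := by
  by_contra! hle
  have hr := root_valid.len_pos
  have hI := h.left.len_pos
  have h1 : 16 / 100 * I.len ≤ J.len :=
    (mul_le_mul_of_nonneg_right I.τ.ratio_ge hI.le).trans h.ratio_left
  have h2 : (16 / 100) ^ m * root.len ≤ I.len :=
    (mul_le_mul_of_nonneg_right (pow_le_pow_of_le_one (by norm_num) (by norm_num) hle) hr.le).trans
      h.len_left
  have h3 : (16 / 100) ^ (2 * m + 1) * root.len ^ 2 ≤ I.len * J.len :=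
    calc (16 / 100) ^ (2 * m + 1) * root.len ^ 2
        = 16 / 100 * (((16 / 100) ^ m * root.len) * ((16 / 100) ^ m * root.len)) := by ring
      _ ≤ 16 / 100 * (I.len * I.len) := by gcongr
      _ = I.len * (16 / 100 * I.len) := by ring
      _ ≤ I.len * J.len := by gcongr
  have h4 := mul_lt_mul_of_pos_right hm (by positivity : 0 < root.len ^ 2)
  linarith

/-- Twice the root interval is `[(√14 - 2)/5, √14 - 2]`, about `[0.35, 1.74]`, which contains the
window `[1/2, 3/2]`. -/
theorem exists_comparable {t : ℝ} (h1 : 1 / 2 ≤ t) (h2 : t ≤ 3 / 2) (k : ℕ) :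
    ∃ I J, Comparable t I J ∧ I.len * J.len ≤ (84 / 100) ^ k * root.len ^ 2 := by
  induction k with
  | zero =>
    refine ⟨root, root, ?_, by rw [pow_zero, one_mul, sq]⟩
    have hr1 := sqrt14_gt
    have hr2 := sqrt14_lt
    have hlo : root.τ.lo = (√14 - 2) / 10 := rfl
    have hhi : root.τ.hi = √14 / 2 - 1 := rfl
    have hrat : root.τ.ratio = 23 / 100 := rfl
    have hpos := root_valid.len_pos
    refine ⟨root_valid, root_valid, ?_, ?_, ?_, ?_, ?_, ?_⟩
    · rw [root_map, hlo]; linarith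
    · rw [root_map, hhi]; linarith
    · rw [hrat]; linarith
    · rw [hrat]; linarith
    · simp [root]
    · simp [root]
  | succ k ih =>
    obtain ⟨I, J, h, hk⟩ := ih
    obtain ⟨I', J', h', hk'⟩ := h.split
    refine ⟨I', J', h', hk'.trans ?_⟩
    rw [pow_succ']
    linarith

theorem Valid.mem_approx {N : Node} (h : N.Valid) {x : ℝ}
    (hx : x ∈ Set.Icc (N.map N.τ.lo) (N.map N.τ.hi)) : x ∈ approx N.n .R2 := by
  have hcont : ContinuousOn N.map (Set.Icc N.τ.lo N.τ.hi) := by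
    change ContinuousOn (fun z => (N.a * z + N.b) / (N.c * z + N.d)) _
    exact ContinuousOn.div (by fun_prop) (by fun_prop) fun z hz =>
      (h.den_pos (N.τ.lo_pos.trans_le hz.1)).ne'
  obtain ⟨z, hz, rfl⟩ := intermediate_value_Icc N.τ.lo_lt_hi.le hcont hx
  exact h.mem 0 z hz

end Node

/-- The sum of the set of admissible expansions with itself contains an interval of length one. -/
theorem exists_add_eq {t : ℝ} (h1 : 1 / 2 ≤ t) (h2 : t ≤ 3 / 2) :
    ∃ x y, x + y = t ∧ (∀ n, x ∈ approx n .R2) ∧ ∀ n, y ∈ approx n .R2 := by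
  have hne : ∀ m, (approx m .R2 ∩ (fun x => t - x) ⁻¹' approx m .R2).Nonempty := by
    intro m
    -- So many splittings that both nodes have depth greater than `m`; the sets at level `m` then
    -- meet, and compactness passes to the limit in `m`.
    obtain ⟨k, hk⟩ := exists_pow_lt_of_lt_one (show (0 : ℝ) < (16 / 100) ^ (2 * m + 1) by positivity)
      (show (84 / 100 : ℝ) < 1 by norm_num)
    obtain ⟨I, J, h, hIJ⟩ := Node.exists_comparable h1 h2 k
    have hI := h.lt_n hIJ hk
    have hJ := h.symm.lt_n (by rwa [mul_comm]) hk
    have hlI : I.len = I.map I.τ.hi - I.map I.τ.lo := rfl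
    have hlJ : J.len = J.map J.τ.hi - J.map J.τ.lo := rfl
    have hpI := h.left.len_pos
    have hpJ := h.right.len_pos
    have hlo := h.lo_le
    have hhi := h.le_hi
    have key : ∃ x, x ∈ Set.Icc (I.map I.τ.lo) (I.map I.τ.hi) ∧
        t - x ∈ Set.Icc (J.map J.τ.lo) (J.map J.τ.hi) := by
      rcases le_total (t - J.map J.τ.hi) (I.map I.τ.lo) with hc | hc
      · exact ⟨I.map I.τ.lo, ⟨le_rfl, by linarith⟩, by linarith, by linarith⟩
      · exact ⟨t - J.map J.τ.hi, ⟨hc, by linarith⟩, by linarith, by linarith⟩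
    obtain ⟨x, hx, hy⟩ := key
    exact ⟨x, approx_antitone _ hI.le (h.left.mem_approx hx),
      approx_antitone _ hJ.le (h.right.mem_approx hy)⟩
  have hcl : ∀ m, IsClosed ((fun x => t - x) ⁻¹' approx m .R2) := fun m =>
    (isCompact_approx m _).isClosed.preimage (by fun_prop)
  obtain ⟨x, hx⟩ := IsCompact.nonempty_iInter_of_sequence_nonempty_isCompact_isClosed
    (fun m => approx m .R2 ∩ (fun x => t - x) ⁻¹' approx m .R2)
    (fun m => Set.inter_subset_inter (approx_succ_subset m _)
      (Set.preimage_mono (approx_succ_subset m _)))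
    hne ((isCompact_approx 0 _).inter_right (hcl 0))
    fun m => (isCompact_approx m _).isClosed.inter (hcl m)
  rw [Set.mem_iInter] at hx
  exact ⟨x, t - x, by ring, fun n => (hx n).1, fun n => (hx n).2⟩

/-! ### Numbers with prescribed digits -/

theorem Digit.act_nonneg (D : Digit) {z : ℝ} (hz : 0 ≤ z) : 0 ≤ D.act z := by
  cases D <;> simp only [Digit.act] <;> positivity

theorem Digit.act_mono (D : Digit) {x y : ℝ} (hx : 0 ≤ x) (hxy : x ≤ y) : D.act x ≤ D.act y :=
  D.act_strictMonoOn.monotoneOn hx (hx.trans hxy) hxy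

theorem actM_le_one {z : ℝ} (hz : 0 ≤ z) : Digit.M.act z ≤ 1 := by
  simp only [Digit.act]; rw [div_le_one (by positivity)]; linarith

theorem half_le_actM {z : ℝ} (hz : 0 ≤ z) : 1 / 2 ≤ Digit.M.act z := by
  simp only [Digit.act]; rw [div_le_div_iff₀ (by positivity) (by positivity)]; linarith

theorem actL_le_half {z : ℝ} (hz : 0 ≤ z) : Digit.L.act z ≤ 1 / 2 := by
  simp only [Digit.act]; rw [div_le_div_iff₀ (by positivity) (by positivity)]; linarith

/-- The value at `0` of the first `k` digits of `e`, starting from position `n`. -/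
noncomputable def truncation (e : ℕ → Digit) : ℕ → ℕ → ℝ
  | 0, _ => 0
  | k + 1, n => (e n).act (truncation e k (n + 1))

theorem truncation_nonneg (e : ℕ → Digit) (k n : ℕ) : 0 ≤ truncation e k n := by
  induction k generalizing n with
  | zero => exact le_rfl
  | succ k ih => exact Digit.act_nonneg _ (ih _)

theorem truncation_mono (e : ℕ → Digit) (n : ℕ) : Monotone fun k => truncation e k n := by
  refine monotone_nat_of_le_succ fun k => ?_
  induction k generalizing n with
  | zero => exact truncation_nonneg e 1 n
  | succ k ih => exact Digit.act_mono _ (truncation_nonneg _ _ _) (ih _)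

/-- The map `M` has values at most `1`, so the next `M` bounds everything before it. Without it an
endless run of `R` would diverge. -/
theorem truncation_bdd {e : ℕ → Digit} (h : ∀ n, ∃ m, e (n + m) = .M) (n : ℕ) :
    BddAbove (Set.range fun k => truncation e k n) := by
  obtain ⟨m, hm⟩ := h n
  induction m generalizing n with
  | zero =>
    refine ⟨1, ?_⟩
    rintro _ ⟨k, rfl⟩
    cases k with
    | zero => exact zero_le_one
    | succ k =>
      simp only [add_zero] at hm
      simp only [truncation, hm]
      exact actM_le_one (truncation_nonneg _ _ _)
  | succ m ih =>
    obtain ⟨B, hB⟩ := ih (n + 1) (by rwa [add_right_comm, add_assoc])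
    have hB' : ∀ k, truncation e k (n + 1) ≤ B := fun k => hB ⟨k, rfl⟩
    have hB0 : 0 ≤ B := (truncation_nonneg e 0 (n + 1)).trans (hB' 0)
    refine ⟨(e n).act B, ?_⟩
    rintro _ ⟨k, rfl⟩
    cases k with
    | zero => exact Digit.act_nonneg _ hB0
    | succ k => exact Digit.act_mono _ (truncation_nonneg _ _ _) (hB' k)

/-- A sequence of digits with infinitely many `M` is the expansion of a positive number. -/
theorem exists_tails {e : ℕ → Digit} (h : ∀ n, ∃ m, e (n + m) = .M) :
    ∃ X : ℕ → ℝ, ∀ n, 0 < X n ∧ X n = (e n).act (X (n + 1)) := by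
  set X : ℕ → ℝ := fun n => ⨆ k, truncation e k n with hX
  have hlim : ∀ n, Filter.Tendsto (fun k => truncation e k n) Filter.atTop (nhds (X n)) :=
    fun n => tendsto_atTop_ciSup (truncation_mono e n) (truncation_bdd h n)
  have hnonneg : ∀ n, 0 ≤ X n := fun n =>
    ge_of_tendsto' (hlim n) fun k => truncation_nonneg e k n
  have hact : ∀ n, X n = (e n).act (X (n + 1)) := by
    intro n
    have h1 := (hlim n).comp (Filter.tendsto_add_atTop_nat 1)
    have h2 : Filter.Tendsto (fun k => (e n).act (truncation e k (n + 1))) Filter.atTop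
        (nhds ((e n).act (X (n + 1)))) := by
      refine ((e n).continuousOn_act (X (n + 1)) (hnonneg _)).tendsto.comp ?_
      exact tendsto_nhdsWithin_iff.2 ⟨hlim _, Filter.Eventually.of_forall fun k =>
        truncation_nonneg e k (n + 1)⟩
    exact tendsto_nhds_unique h1 h2
  refine ⟨X, fun n => ⟨?_, hact n⟩⟩
  obtain ⟨m, hm⟩ := h n
  induction m generalizing n with
  | zero =>
    rw [hact, show e n = .M from hm]
    linarith [half_le_actM (hnonneg (n + 1))]
  | succ m ih =>
    rw [hact]
    exact Digit.act_pos _ (ih (n + 1) (by rwa [add_right_comm, add_assoc]))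

/-- The Möbius transformation given by the first `k` digits of `e`. -/
def prefixNode (e : ℕ → Digit) : ℕ → Node
  | 0 => Node.root
  | k + 1 => (prefixNode e k).child (e k) .F

theorem prefixNode_map {e : ℕ → Digit} {z : ℕ → ℝ} {k : ℕ} (hpos : ∀ i ≤ k, 0 < z i)
    (hz : ∀ i < k, z i = (e i).act (z (i + 1))) : (prefixNode e k).map (z k) = z 0 := by
  induction k with
  | zero => exact Node.root_map _
  | succ k ih =>
    rw [prefixNode, Node.map_child _ _ _ (hpos _ le_rfl), ← hz k (by omega)]
    exact ih (fun i hi => hpos i (by omega)) fun i hi => hz i (by omega)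

/-- The image of `(0, ∞)` under the prefix has length `Δ / (c d)`, hence at most `1 / (k + 1)`. The
bounds `Δ ≤ c²` and `Δ ≤ 2 d²` carry the induction: `R` adds `c²` to `c d`, `L` adds `2 d²`, and `M`
doubles `Δ`. A first digit different from `R` makes `c` positive. The state `F` stored in these
nodes is a placeholder. -/
theorem prefixNode_bounds {e : ℕ → Digit} (he : e 0 ≠ .R) (k : ℕ) :
    let N := prefixNode e (k + 1)
    let Δ := N.a * N.d - N.b * N.c
    0 < N.c ∧ 0 < N.d ∧ 0 < Δ ∧ Δ ≤ N.c ^ 2 ∧ Δ ≤ 2 * N.d ^ 2 ∧ (k + 1) * Δ ≤ N.c * N.d := by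
  induction k with
  | zero =>
    cases h : e 0
    · simp [prefixNode, h, Node.child, Node.root]
    · simp [prefixNode, h, Node.child, Node.root]; norm_num
    · exact absurd h he
  | succ k ih =>
    rw [prefixNode]
    obtain ⟨h1, h2, h3, h4, h5, h6⟩ := ih
    generalize prefixNode e (k + 1) = N at *
    push_cast
    have h7 : N.a * N.d - N.b * N.c ≤ N.c * N.d :=
      (le_mul_of_one_le_left h3.le (by linarith [Nat.cast_nonneg (α := ℝ) k])).trans h6
    have h8 := mul_pos h1 h2
    cases e (k + 1) <;> simp only [Node.child]
    · refine ⟨by positivity, h2, by linarith, by nlinarith, by linarith, by nlinarith⟩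
    · refine ⟨by positivity, by positivity, by linarith, by nlinarith, by nlinarith, by nlinarith⟩
    · refine ⟨h1, by positivity, by linarith, by linarith, by nlinarith, by nlinarith⟩

/-- Two numbers with the same first `k` digits are close. -/
theorem abs_sub_le_of_digits_eq {e : ℕ → Digit} (he : e 0 ≠ .R) {z z' : ℕ → ℝ} {k : ℕ}
    (hpos : ∀ i ≤ k, 0 < z i) (hz : ∀ i < k, z i = (e i).act (z (i + 1)))
    (hpos' : ∀ i ≤ k, 0 < z' i) (hz' : ∀ i < k, z' i = (e i).act (z' (i + 1))) (hk : 0 < k) :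
    |z 0 - z' 0| ≤ 1 / k := by
  obtain ⟨j, rfl⟩ : ∃ j, k = j + 1 := ⟨k - 1, by omega⟩
  rw [← prefixNode_map hpos hz, ← prefixNode_map hpos' hz']
  have hp := hpos _ le_rfl
  have hp' := hpos' _ le_rfl
  generalize z (j + 1) = x at *
  generalize z' (j + 1) = y at *
  obtain ⟨h1, h2, h3, -, -, h6⟩ := prefixNode_bounds he j
  generalize prefixNode e (j + 1) = N at *
  have h7 : 0 < N.c * x + N.d := by positivity
  have h8 : 0 < N.c * y + N.d := by positivity
  have h9 : N.map x - N.map y =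
      (N.a * N.d - N.b * N.c) * (x - y) / ((N.c * x + N.d) * (N.c * y + N.d)) := by
    rw [Node.map, Node.map, div_sub_div _ _ h7.ne' h8.ne']
    congr 1; ring
  rw [h9, abs_div, abs_mul, abs_of_pos h3, abs_of_pos (mul_pos h7 h8),
    div_le_div_iff₀ (by positivity) (by positivity)]
  have h10 : |x - y| ≤ x + y := abs_le.2 ⟨by linarith, by linarith⟩
  push_cast
  -- The estimate `(c x + d)(c y + d) ≥ c d (x + y)` absorbs the unbounded tails.
  calc (N.a * N.d - N.b * N.c) * |x - y| * (j + 1)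
      ≤ (N.a * N.d - N.b * N.c) * (x + y) * (j + 1) := by gcongr
    _ = ((j + 1) * (N.a * N.d - N.b * N.c)) * (x + y) := by ring
    _ ≤ N.c * N.d * (x + y) := by gcongr
    _ ≤ 1 * ((N.c * x + N.d) * (N.c * y + N.d)) := by
      have : 0 ≤ N.c * N.c * (x * y) := by positivity
      nlinarith [mul_pos h2 h2]
-- Digit paths acting on forms
noncomputable section

/-- The matrices attached to the digits. -/
def Digit.mat : Digit → SL(2, ℝ)
  | .L => ⟨!![1, 0; √2, 1], by simp [Matrix.det_fin_two]⟩
  | .M => ⟨!![√2, 1; 1, √2], by rw [Matrix.det_fin_two_of, sqrt_two_mul_self]; norm_num⟩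
  | .R => unip √2

theorem heckeS_inv_eq : ((heckeS⁻¹ : SL(2, ℝ)) : Matrix (Fin 2) (Fin 2) ℝ) = !![0, 1; -1, 0] := by
  rw [Matrix.SpecialLinearGroup.SL2_inv_expl]; simp [heckeS, Matrix.of_apply]; rfl

theorem Digit.mat_mem (D : Digit) : D.mat ∈ heckeGroup 4 := by
  cases D
  · have h := Subgroup.mul_mem _ (Subgroup.mul_mem _ heckeS_mem (unip_int_mem (-1)))
      (Subgroup.inv_mem _ heckeS_mem)
    convert h
    apply Subtype.ext
    rw [Matrix.SpecialLinearGroup.coe_mul, Matrix.SpecialLinearGroup.coe_mul, heckeS_inv_eq]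
    simp [mat, unip, heckeS]
  · have h := Subgroup.mul_mem _ (Subgroup.mul_mem _ unip_sqrt_two_mem heckeS_mem)
      unip_sqrt_two_mem
    convert h
    apply Subtype.ext
    rw [Matrix.SpecialLinearGroup.coe_mul, Matrix.SpecialLinearGroup.coe_mul]
    simp [mat, unip, heckeS]
    norm_num
  · exact unip_sqrt_two_mem

/-- The form of discriminant `1` with roots `√2 X` and `-√2 P`. -/
def rootForm (X P : ℝ) : BinForm where
  a := 1 / (√2 * (X + P))
  b := (P - X) / (X + P)
  c := -(√2 * X * P) / (X + P)

theorem rootForm_disc {X P : ℝ} (h : 0 < X + P) : (rootForm X P).disc = 1 := by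
  have h2 : √(2 : ℝ) ≠ 0 := by positivity
  simp only [rootForm, BinForm.disc]
  field_simp
  ring

theorem rootForm_eval {X P : ℝ} (h : 0 < X + P) (v : Fin 2 → ℝ) :
    (rootForm X P).eval v = (v 0 - √2 * X * v 1) * (v 0 + √2 * P * v 1) / (√2 * (X + P)) := by
  have h2 : √(2 : ℝ) ≠ 0 := by positivity
  simp only [rootForm, BinForm.eval]
  field_simp
  ring

/-- Conjugation by `z ↦ -z` turns each digit map into its inverse. Hence pulling back by the digit
removes it from `X` and prepends it to `P`. -/
theorem rootForm_eval_mat {X X' P : ℝ} (D : Digit) (hX' : 0 < X') (hP : 0 ≤ P)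
    (hX : X = D.act X') (v : Fin 2 → ℝ) :
    (rootForm X P).eval ((D.mat : Matrix (Fin 2) (Fin 2) ℝ) *ᵥ v) =
      (rootForm X' (D.act P)).eval v := by
  have h2 : √(2 : ℝ) ≠ 0 := by positivity
  have hs : √(2 : ℝ) ^ 2 = 2 := Real.sq_sqrt (by norm_num)
  have hXpos : 0 < X := hX ▸ D.act_pos hX'
  have hP' := D.act_nonneg hP
  rw [rootForm_eval (by positivity), rootForm_eval (by positivity), mulVec_eq]
  obtain ⟨x, hx⟩ : ∃ x, x = v 0 := ⟨_, rfl⟩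
  obtain ⟨y, hy⟩ : ∃ y, y = √2 * v 1 := ⟨_, rfl⟩
  have hy' : v 1 = √2 * y / 2 := by rw [hy]; linear_combination -(v 1) / 2 * hs
  -- The coordinates `x = v 0` and `y = √2 v 1` make the identities rational.
  rw [mul_right_comm √2 X', mul_right_comm √2 (D.act P) (v 1), ← hy, ← hx]
  cases D
  · have e1 : (x - √2 * X * (√2 * x + v 1)) * (x + √2 * P * (√2 * x + v 1)) =
        (x - 2 * X * x - X * y) * (x + 2 * P * x + P * y) := by
      congr 1
      · rw [hy]; linear_combination -X * x * hs
      · rw [hy]; linear_combination P * x * hs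
    have h3 : 1 + 2 * X' ≠ 0 := by positivity
    have h4 : 1 + 2 * P ≠ 0 := by positivity
    have h5 : 0 < X' + P / (1 + 2 * P) := by positivity
    have h6 : 0 < X' / (1 + 2 * X') + P := by positivity
    simp only [Digit.mat, Matrix.cons_val_zero, Matrix.cons_val_one, Digit.act] at hX ⊢
    simp only [Matrix.of_apply, Matrix.cons_val', Matrix.cons_val_zero,
      Matrix.cons_val_one, Matrix.cons_val_fin_one, one_mul, zero_mul, add_zero, e1]
    rw [hX, div_eq_div_iff (by positivity) (by positivity)]
    field_simp
    ring
  · have e1 : (√2 * x + v 1 - √2 * X * (x + √2 * v 1)) * (√2 * x + v 1 + √2 * P * (x + √2 * v 1)) =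
        2 * (x + y / 2 - X * x - X * y) * (x + y / 2 + P * x + P * y) := by
      rw [← hy, hy']
      linear_combination (x + y / 2 - X * x - X * y) * (x + y / 2 + P * x + P * y) * hs
    have h3 : 2 * X' + 2 ≠ 0 := by positivity
    have h4 : 2 * P + 2 ≠ 0 := by positivity
    simp only [Digit.mat, Matrix.cons_val_zero, Matrix.cons_val_one, Digit.act] at hX ⊢
    simp only [Matrix.of_apply, Matrix.cons_val', Matrix.cons_val_zero,
      Matrix.cons_val_one, Matrix.cons_val_fin_one, one_mul, e1]
    rw [hX, div_eq_div_iff (by positivity) (by positivity)]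
    field_simp
    ring
  · simp only [Digit.mat, unip, Digit.act, Matrix.cons_val_zero, Matrix.cons_val_one] at hX ⊢
    simp only [Matrix.of_apply, Matrix.cons_val', Matrix.cons_val_zero,
      Matrix.cons_val_one, Matrix.cons_val_fin_one, one_mul, zero_mul, zero_add]
    rw [hX, ← hy]
    congr 1
    · rw [hy]; ring
    · ring

theorem exists_preimage {M : SL(2, ℝ)} (hM : M ∈ heckeGroup 4) {v : Fin 2 → ℝ}
    (hv : IsCuspVector v) :
    ∃ u, IsCuspVector u ∧ (M : Matrix (Fin 2) (Fin 2) ℝ) *ᵥ u = v ∧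
      u 0 = M 1 1 * v 0 - M 0 1 * v 1 ∧ u 1 = M 0 0 * v 1 - M 1 0 * v 0 := by
  refine ⟨((M⁻¹ : SL(2, ℝ)) : Matrix (Fin 2) (Fin 2) ℝ) *ᵥ v, ?_, ?_, ?_, ?_⟩
  · rw [← mem_cuspOrbit_iff] at hv ⊢
    exact mulVec_mem_cuspOrbit (Subgroup.inv_mem _ hM) hv
  · rw [Matrix.mulVec_mulVec, ← Matrix.SpecialLinearGroup.coe_mul, mul_inv_cancel]
    simp
  · rw [mulVec_eq, Matrix.SpecialLinearGroup.SL2_inv_expl]; simp; ring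
  · rw [mulVec_eq, Matrix.SpecialLinearGroup.SL2_inv_expl]; simp; ring

theorem half_le_abs_rootForm {X P α : ℝ} (hX : 0 < X) (hP : 0 ≤ P) {v : Fin 2 → ℝ}
    (h0 : 1 ≤ v 0) (h1 : 1 ≤ v 1) (hα : α ≤ |v 0 - √2 * X * v 1|)
    (h : √2 * (X + P) / 2 ≤ α * (1 + √2 * P)) : 1 / 2 ≤ |(rootForm X P).eval v| := by
  have h2 : (0 : ℝ) < √2 := by positivity
  have hwP : 0 ≤ √2 * P := by positivity
  have hB : 1 + √2 * P ≤ v 0 + √2 * P * v 1 := by nlinarith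
  have hpos : 0 < √2 * (X + P) := by positivity
  rw [rootForm_eval (by positivity), abs_div, abs_mul, abs_of_pos hpos,
    abs_of_pos (show 0 < v 0 + √2 * P * v 1 by linarith), le_div_iff₀ hpos]
  calc 1 / 2 * (√2 * (X + P)) = √2 * (X + P) / 2 := by ring
    _ ≤ α * (1 + √2 * P) := h
    _ ≤ _ := by gcongr

/-- The expansion `w` of a number `√2 X 0`, with tails `√2 X n` and poles `-√2 P n`. -/
structure DigitPath (w : ℕ → Digit) (X P : ℕ → ℝ) : Prop where
  posX : ∀ n, 0 < X n
  actX : ∀ n, X n = (w n).act (X (n + 1))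
  zeroP : P 0 = 0
  actP : ∀ n, P (n + 1) = (w n).act (P n)

/-- The product of the matrices of the first `n` digits. -/
def pathMat (w : ℕ → Digit) : ℕ → SL(2, ℝ)
  | 0 => 1
  | n + 1 => pathMat w n * (w n).mat

theorem pathMat_mem (w : ℕ → Digit) (n : ℕ) : pathMat w n ∈ heckeGroup 4 := by
  induction n with
  | zero => exact Subgroup.one_mem _
  | succ n ih => exact Subgroup.mul_mem _ ih (w n).mat_mem

theorem pathMat_succ_mulVec (w : ℕ → Digit) (n : ℕ) (v : Fin 2 → ℝ) :
    (pathMat w (n + 1) : Matrix (Fin 2) (Fin 2) ℝ) *ᵥ v =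
      (pathMat w n : Matrix (Fin 2) (Fin 2) ℝ) *ᵥ
        (((w n).mat : Matrix (Fin 2) (Fin 2) ℝ) *ᵥ v) := by
  rw [Matrix.mulVec_mulVec, ← Matrix.SpecialLinearGroup.coe_mul]; rfl

namespace DigitPath

variable {w : ℕ → Digit} {X P : ℕ → ℝ}

theorem nonnegP (h : DigitPath w X P) (n : ℕ) : 0 ≤ P n := by
  induction n with
  | zero => exact h.zeroP.ge
  | succ n ih => rw [h.actP]; exact Digit.act_nonneg _ ih

theorem eval_pathMat (h : DigitPath w X P) (n : ℕ) (v : Fin 2 → ℝ) :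
    (rootForm (X 0) (P 0)).eval ((pathMat w n : Matrix (Fin 2) (Fin 2) ℝ) *ᵥ v) =
      (rootForm (X n) (P n)).eval v := by
  induction n generalizing v with
  | zero => simp [pathMat]
  | succ n ih =>
    rw [pathMat_succ_mulVec, ih, rootForm_eval_mat _ (h.posX _) (h.nonnegP n) (h.actX n), h.actP]

/-- Either `v` lies in the sector of the digit `w n` and can be pulled back, or a side of that
sector separates `v` from the root. In the second case the negative coordinate of the pulled back
vector is at most `-1` by discreteness, which gives the distance `α`; for the digit `R` it has to
grow with `X`. -/
theorem bound_or_descend (h : DigitPath w X P) (n : ℕ) {v : Fin 2 → ℝ} (hv : IsCuspVector v)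
    (h0 : 1 ≤ v 0) (h1 : 1 ≤ v 1) :
    1 / 2 ≤ |(rootForm (X n) (P n)).eval v| ∨
      ∃ u, IsCuspVector u ∧ 0 ≤ u 0 ∧ 0 ≤ u 1 ∧ u 0 + u 1 + 1 ≤ v 0 + v 1 ∧
        ((w n).mat : Matrix (Fin 2) (Fin 2) ℝ) *ᵥ u = v := by
  obtain ⟨u, hu, huv, hu0, hu1⟩ := exists_preimage (w n).mat_mem hv
  have hX := h.posX n
  have hX' := h.posX (n + 1)
  have hact := h.actX n
  have hP := h.nonnegP n
  have hs : √(2 : ℝ) * √2 = 2 := sqrt_two_mul_self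
  have hs1 : 1.4 < √(2 : ℝ) := Real.lt_sqrt_of_sq_lt (by norm_num)
  have hs2 : √(2 : ℝ) < 1.5 := (Real.sqrt_lt' (by norm_num)).2 (by norm_num)
  have hwP : 0 ≤ √2 * P n := by positivity
  generalize X n = Y at *
  generalize P n = Q at *
  cases hD : w n <;> rw [hD] at huv hu0 hu1 hact <;> simp [Digit.mat, unip] at hu0 hu1
  · have hY := actL_le_half hX'.le
    rw [← hact] at hY
    by_cases hz : 0 ≤ u 1
    · right
      exact ⟨u, hu, by linarith, hz, by nlinarith, huv⟩
    · left
      push Not at hz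
      have hz1 := hu.one_le_abs_one hz.ne
      rw [abs_of_neg hz] at hz1
      refine half_le_abs_rootForm (α := √2 / 2) hX hP h0 h1 ?_ (by nlinarith)
      refine le_trans ?_ (le_abs_self _)
      have e1 := mul_nonneg (Real.sqrt_nonneg 2) (show 0 ≤ √2 * v 0 - v 1 - 1 by linarith)
      have e2 := mul_nonneg (sub_nonneg.2 hY) (show 0 ≤ √2 * v 1 by positivity)
      linear_combination (1 / 2) * e1 + e2 + v 0 / 2 * hs
  · have hY := actM_le_one hX'.le
    have hY' := half_le_actM hX'.le
    rw [← hact] at hY hY'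
    by_cases hz : 0 ≤ u 0
    · by_cases hz' : 0 ≤ u 1
      · right
        exact ⟨u, hu, hz, hz', by nlinarith, huv⟩
      · left
        push Not at hz'
        have hz1 := hu.one_le_abs_one hz'.ne
        rw [abs_of_neg hz'] at hz1
        refine half_le_abs_rootForm (α := 1) hX hP h0 h1 ?_ (by nlinarith)
        refine le_trans ?_ (le_abs_self _)
        nlinarith [mul_nonneg (sub_nonneg.2 hY) (show 0 ≤ √2 * v 1 by positivity)]
    · left
      push Not at hz
      have hz1 := hu.one_le_abs_zero hz.ne
      rw [abs_of_neg hz] at hz1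
      refine half_le_abs_rootForm (α := √2 / 2) hX hP h0 h1 ?_ (by nlinarith)
      refine le_trans ?_ (neg_le_abs _)
      nlinarith [mul_nonneg (sub_nonneg.2 hY') (show 0 ≤ √2 * v 1 by positivity)]
  · have hY : 1 ≤ Y := by rw [hact]; simp only [Digit.act]; linarith
    by_cases hz : 0 ≤ u 0
    · right
      exact ⟨u, hu, hz, by linarith, by nlinarith, huv⟩
    · left
      push Not at hz
      have hz1 := hu.one_le_abs_zero hz.ne
      rw [abs_of_neg hz] at hz1
      have hα : 0 ≤ √2 * (Y - 1) := mul_nonneg (by positivity) (by linarith)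
      refine half_le_abs_rootForm (α := √2 * (Y - 1) + 1) hX hP h0 h1 ?_
        (by nlinarith [mul_nonneg hα hwP])
      refine le_trans ?_ (neg_le_abs _)
      nlinarith [mul_nonneg hα (sub_nonneg.2 h1)]

/-- Each descent lowers the coordinate sum by at least one, so it ends at `(1, 0)` or `(0, 1)`, that
is, at a vertex of a square on the path. -/
theorem bound_or_vertex (h : DigitPath w X P) (B n : ℕ) {v : Fin 2 → ℝ} (hv : IsCuspVector v)
    (h0 : 0 ≤ v 0) (h1 : 0 ≤ v 1) (hB : v 0 + v 1 ≤ B) :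
    1 / 2 ≤ |(rootForm (X n) (P n)).eval v| ∨
      ∃ m, (pathMat w n : Matrix (Fin 2) (Fin 2) ℝ) *ᵥ v =
          (pathMat w m : Matrix (Fin 2) (Fin 2) ℝ) *ᵥ ![1, 0] ∨
        (pathMat w n : Matrix (Fin 2) (Fin 2) ℝ) *ᵥ v =
          (pathMat w m : Matrix (Fin 2) (Fin 2) ℝ) *ᵥ ![0, 1] := by
  induction B generalizing n v with
  | zero =>
    exfalso
    have h2 : v 0 = 0 := by push_cast at hB; linarith
    have h3 : v 1 = 0 := by push_cast at hB; linarith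
    rcases hv.eq_of_one_eq_zero h3 with h4 | h4 <;> rw [h4] at h2 <;> simp at h2
  | succ B ih =>
    rcases h0.eq_or_lt with h2 | h2
    · rcases hv.eq_of_zero_eq_zero h2.symm with h3 | h3
      · exact Or.inr ⟨n, Or.inr (by rw [h3])⟩
      · rw [h3] at h1; norm_num at h1
    rcases h1.eq_or_lt with h3 | h3
    · rcases hv.eq_of_one_eq_zero h3.symm with h3 | h3
      · exact Or.inr ⟨n, Or.inl (by rw [h3])⟩
      · rw [h3] at h0; norm_num at h0
    have h4 := hv.one_le_abs_zero h2.ne'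
    have h5 := hv.one_le_abs_one h3.ne'
    rw [abs_of_pos h2] at h4
    rw [abs_of_pos h3] at h5
    rcases h.bound_or_descend n hv h4 h5 with h6 | ⟨u, hu, hu0, hu1, hlt, huv⟩
    · exact Or.inl h6
    · have := ih (n + 1) hu hu0 hu1 (by push_cast at hB; linarith)
      rw [pathMat_succ_mulVec, huv] at this
      refine this.imp_left fun h7 => ?_
      rwa [h.actP, ← rootForm_eval_mat _ (h.posX _) (h.nonnegP n) (h.actX n), huv] at h7

end DigitPath

end

/-! ### The combinatorics of Hall's word -/

/-- The position at which the `k`-th block of `hallWord` starts. -/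
def blockStart (N k : ℕ) : ℕ := k * k + k * N

theorem blockStart_succ (N k : ℕ) : blockStart N (k + 1) = blockStart N k + (2 * k + 1 + N) := by
  simp only [blockStart]; ring

theorem blockStart_strictMono (N : ℕ) : StrictMono (blockStart N) :=
  strictMono_nat_of_lt_succ fun k => by rw [blockStart_succ]; omega

/-- The concatenation of the blocks `M, u (k - 1), …, u 0, R, …, R, v 0, …, v (k - 1)`, where `R`
occurs `N` times in the middle. -/
def hallWord (u v : ℕ → Digit) (N n : ℕ) : Digit :=
  let k := Nat.findGreatest (fun k => blockStart N k ≤ n) n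
  let o := n - blockStart N k
  if o = 0 then .M else if o ≤ k then u (k - o) else if o ≤ k + N then .R else v (o - k - N - 1)

theorem findGreatest_blockStart {N k o : ℕ} (ho : o < 2 * k + 1 + N) :
    Nat.findGreatest (fun j => blockStart N j ≤ blockStart N k + o) (blockStart N k + o) = k := by
  rw [Nat.findGreatest_eq_iff]
  refine ⟨((blockStart_strictMono N).id_le k).trans (Nat.le_add_right _ _),
    fun _ => Nat.le_add_right _ _, fun j hj _ hle => ?_⟩
  have h1 := (blockStart_strictMono N).monotone (Nat.succ_le_of_lt hj)
  rw [Nat.succ_eq_add_one, blockStart_succ] at h1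
  omega

theorem exists_block (N n : ℕ) : ∃ k o, n = blockStart N k + o ∧ o < 2 * k + 1 + N := by
  set k := Nat.findGreatest (fun k => blockStart N k ≤ n) n with hk
  have h1 : blockStart N k ≤ n :=
    Nat.findGreatest_spec (P := fun k => blockStart N k ≤ n) (Nat.zero_le n) (by simp [blockStart])
  refine ⟨k, n - blockStart N k, by omega, ?_⟩
  by_contra! h2
  have h3 : blockStart N (k + 1) ≤ n := by rw [blockStart_succ]; omega
  have h4 : k + 1 ≤ k := Nat.le_findGreatest
    (((blockStart_strictMono N).id_le (k + 1)).trans h3) h3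
  omega

section

variable (u v : ℕ → Digit) {N : ℕ}

theorem hallWord_eq {k o : ℕ} (ho : o < 2 * k + 1 + N) :
    hallWord u v N (blockStart N k + o) = if o = 0 then .M else if o ≤ k then u (k - o) else
      if o ≤ k + N then .R else v (o - k - N - 1) := by
  simp only [hallWord, findGreatest_blockStart ho, Nat.add_sub_cancel_left]

theorem hallWord_start (k : ℕ) : hallWord u v N (blockStart N k) = .M :=
  hallWord_eq u v (o := 0) (by omega)

theorem hallWord_left {k o : ℕ} (h1 : 1 ≤ o) (h2 : o ≤ k) :
    hallWord u v N (blockStart N k + o) = u (k - o) := by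
  rw [hallWord_eq u v (by omega), if_neg (by omega), if_pos h2]

theorem hallWord_run {k o : ℕ} (h1 : k < o) (h2 : o ≤ k + N) :
    hallWord u v N (blockStart N k + o) = .R := by
  rw [hallWord_eq u v (by omega), if_neg (by omega), if_neg (by omega), if_pos h2]

theorem hallWord_right {k o : ℕ} (h1 : k + N < o) (h2 : o < 2 * k + 1 + N) :
    hallWord u v N (blockStart N k + o) = v (o - k - N - 1) := by
  rw [hallWord_eq u v (by omega), if_neg (by omega), if_neg (by omega), if_neg (by omega)]

theorem hallWord_end {k o : ℕ} (h : o = 2 * k + 1 + N) :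
    hallWord u v N (blockStart N k + o) = .M := by
  rw [h, ← blockStart_succ, hallWord_start]

variable {u v}

/-- The pieces taken from `u` and `v` are separated by the letters `M` and by runs of `R`, so three
consecutive `L` would lie in a single piece. -/
theorem hallWord_noL (hN : 1 ≤ N) (hu : ∀ n, ¬ (u n = .L ∧ u (n + 1) = .L ∧ u (n + 2) = .L))
    (hv : ∀ n, ¬ (v n = .L ∧ v (n + 1) = .L ∧ v (n + 2) = .L)) (n : ℕ) :
    ¬ (hallWord u v N n = .L ∧ hallWord u v N (n + 1) = .L ∧ hallWord u v N (n + 2) = .L) := by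
  rintro ⟨h0, h1, h2⟩
  obtain ⟨k, o, rfl, ho⟩ := exists_block N n
  rw [add_assoc] at h1 h2
  rcases Nat.eq_zero_or_pos o with rfl | ho0
  · rw [add_zero, hallWord_start] at h0; cases h0
  by_cases ho1 : o ≤ k
  · rw [hallWord_left u v ho0 ho1] at h0
    by_cases ho2 : o + 1 ≤ k
    · rw [hallWord_left u v (by omega) ho2] at h1
      by_cases ho3 : o + 2 ≤ k
      · rw [hallWord_left u v (by omega) ho3] at h2
        refine hu (k - (o + 2)) ⟨h2, ?_, ?_⟩
        · rwa [show k - (o + 2) + 1 = k - (o + 1) by omega]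
        · rwa [show k - (o + 2) + 2 = k - o by omega]
      · rw [hallWord_run u v (by omega) (by omega)] at h2; cases h2
    · rw [hallWord_run u v (by omega) (by omega)] at h1; cases h1
  by_cases ho2 : o ≤ k + N
  · rw [hallWord_run u v (by omega) ho2] at h0; cases h0
  rw [hallWord_right u v (by omega) ho] at h0
  by_cases ho3 : o + 1 = 2 * k + 1 + N
  · rw [hallWord_end u v ho3] at h1; cases h1
  rw [hallWord_right u v (by omega) (by omega)] at h1
  by_cases ho4 : o + 2 = 2 * k + 1 + N
  · rw [hallWord_end u v ho4] at h2; cases h2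
  rw [hallWord_right u v (by omega) (by omega)] at h2
  refine hv (o - k - N - 1) ⟨h0, ?_, ?_⟩
  · rwa [show o - k - N - 1 + 1 = o + 1 - k - N - 1 by omega]
  · rwa [show o - k - N - 1 + 2 = o + 2 - k - N - 1 by omega]

/-- As `u 0` is not `R`, no such run begins inside a reversed piece, and the letter `M` ends every
piece of `v`. What remains is the position just before a run `R^N`. -/
theorem hallWord_run_start (hu0 : u 0 ≠ .R)
    (hu : ∀ n, ¬ (u n = .R ∧ u (n + 1) = .R ∧ u (n + 2) = .R))
    (hv : ∀ n, ¬ (v n = .R ∧ v (n + 1) = .R ∧ v (n + 2) = .R)) {n : ℕ}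
    (h0 : hallWord u v N n ≠ .R) (h1 : hallWord u v N (n + 1) = .R)
    (h2 : hallWord u v N (n + 2) = .R) (h3 : hallWord u v N (n + 3) = .R) :
    ∃ k, n = blockStart N k + k := by
  obtain ⟨k, o, rfl, ho⟩ := exists_block N n
  refine ⟨k, ?_⟩
  rw [add_assoc] at h1 h2 h3
  by_cases ho1 : o ≤ k
  · rcases ho1.eq_or_lt with rfl | ho2
    · rfl
    exfalso
    rw [hallWord_left u v (by omega) (by omega)] at h1
    rcases Nat.eq_or_lt_of_le ho2 with ho2 | ho2
    · rw [show k - (o + 1) = 0 by omega] at h1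
      exact hu0 h1
    rw [hallWord_left u v (by omega) (by omega)] at h2
    rcases Nat.eq_or_lt_of_le ho2 with ho2 | ho2
    · rw [show k - (o + 2) = 0 by omega] at h2
      exact hu0 h2
    rw [hallWord_left u v (by omega) (by omega)] at h3
    refine hu (k - (o + 3)) ⟨h3, ?_, ?_⟩
    · rwa [show k - (o + 3) + 1 = k - (o + 2) by omega]
    · rwa [show k - (o + 3) + 2 = k - (o + 1) by omega]
  exfalso
  by_cases ho2 : o ≤ k + N
  · exact h0 (hallWord_run u v (by omega) ho2)
  by_cases ho3 : o + 1 = 2 * k + 1 + N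
  · rw [hallWord_end u v ho3] at h1; cases h1
  rw [hallWord_right u v (by omega) (by omega)] at h1
  by_cases ho4 : o + 2 = 2 * k + 1 + N
  · rw [hallWord_end u v ho4] at h2; cases h2
  rw [hallWord_right u v (by omega) (by omega)] at h2
  by_cases ho5 : o + 3 = 2 * k + 1 + N
  · rw [hallWord_end u v ho5] at h3; cases h3
  rw [hallWord_right u v (by omega) (by omega)] at h3
  refine hv (o + 1 - k - N - 1) ⟨h1, ?_, ?_⟩
  · rwa [show o + 1 - k - N - 1 + 1 = o + 2 - k - N - 1 by omega]
  · rwa [show o + 1 - k - N - 1 + 2 = o + 3 - k - N - 1 by omega]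

end

/-! ### Values of the form at the vertices of the path -/

theorem Digit.act_le_one {D : Digit} (hD : D ≠ .R) {z : ℝ} (hz : 0 ≤ z) : D.act z ≤ 1 := by
  cases D
  · exact (actL_le_half hz).trans (by norm_num)
  · exact actM_le_one hz
  · exact absurd rfl hD

theorem Digit.half_le_act {D : Digit} (hD : D ≠ .L) {z : ℝ} (hz : 0 ≤ z) : 1 / 2 ≤ D.act z := by
  cases D
  · exact absurd rfl hD
  · exact half_le_actM hz
  · rw [actR]; linarith

theorem rootForm_eval_e1 {X P : ℝ} : (rootForm X P).eval ![1, 0] = 1 / (√2 * (X + P)) := by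
  simp [rootForm, BinForm.eval]

theorem rootForm_eval_e2 {X P : ℝ} : (rootForm X P).eval ![0, 1] = -(√2 * X * P) / (X + P) := by
  simp [rootForm, BinForm.eval]

theorem BinForm.eval_neg (f : BinForm) (v : Fin 2 → ℝ) : f.eval (-v) = f.eval v := by
  simp [BinForm.eval]

namespace DigitPath

variable {w : ℕ → Digit} {X P : ℕ → ℝ}

theorem X_le_three (h : DigitPath w X P) {n : ℕ}
    (hn : ¬ (w n = .R ∧ w (n + 1) = .R ∧ w (n + 2) = .R)) : X n ≤ 3 := by
  have h1 := h.posX (n + 1)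
  have h2 := h.posX (n + 1 + 1)
  have h3 := h.posX (n + 2 + 1)
  by_cases e0 : w n = .R
  · by_cases e1 : w (n + 1) = .R
    · have e2 : w (n + 2) ≠ .R := fun e2 => hn ⟨e0, e1, e2⟩
      have := Digit.act_le_one e2 h3.le
      rw [h.actX n, e0, actR, h.actX (n + 1), e1, actR, h.actX (n + 1 + 1)]
      linarith
    · have := Digit.act_le_one e1 h2.le
      rw [h.actX n, e0, actR, h.actX (n + 1)]
      linarith
  · rw [h.actX n]
    linarith [Digit.act_le_one e0 h1.le]

theorem sixth_le_X (h : DigitPath w X P) {n : ℕ}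
    (hn : ¬ (w n = .L ∧ w (n + 1) = .L ∧ w (n + 2) = .L)) : 1 / 6 ≤ X n := by
  have h1 := h.posX (n + 1)
  have h2 := h.posX (n + 1 + 1)
  have h3 := h.posX (n + 2 + 1)
  have q1 : Digit.L.act (1 / 2) = 1 / 4 := by simp only [Digit.act]; norm_num
  have q2 : Digit.L.act (1 / 4) = 1 / 6 := by simp only [Digit.act]; norm_num
  by_cases e0 : w n = .L
  · by_cases e1 : w (n + 1) = .L
    · have e2 : w (n + 2) ≠ .L := fun e2 => hn ⟨e0, e1, e2⟩
      have := Digit.half_le_act e2 h3.le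
      rw [h.actX n, e0, h.actX (n + 1), e1, h.actX (n + 1 + 1), ← q2, ← q1]
      exact Digit.act_mono _ (by rw [q1]; norm_num) (Digit.act_mono _ (by norm_num) this)
    · have := Digit.half_le_act e1 h2.le
      have h4 := Digit.L.act_mono (by norm_num) this
      rw [h.actX n, e0, h.actX (n + 1)]
      linarith
  · rw [h.actX n]
    linarith [Digit.half_le_act e0 h1.le]

/-- Take the first square on the path having `v` as the given vertex. As `R` fixes `(1, 0)` and `L`
fixes `(0, 1)`, the digit before it is not `R`, resp. not `L`, so `P ≤ 1`, resp. `P ≥ 1/2`. With `X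
≤ 3`, resp. `X ≥ 1/6`, the estimates are `X + P ≤ 4` and `1/X + 1/P ≤ 8`. -/
theorem bound_of_nonneg (h : DigitPath w X P) (hL : ∀ n, ¬ (w n = .L ∧ w (n + 1) = .L ∧ w (n + 2) = .L))
    {v : Fin 2 → ℝ} (hv : IsCuspVector v) (h1 : v ≠ ![1, 0]) (h2 : v ≠ ![0, 1])
    (hv0 : 0 ≤ v 0) (hv1 : 0 ≤ v 1) :
    1 ≤ 4 * √2 * |(rootForm (X 0) (P 0)).eval v| ∨
      ∃ j, w j ≠ .R ∧ w (j + 1) = .R ∧ w (j + 2) = .R ∧ w (j + 3) = .R ∧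
        v = firstCol (pathMat w (j + 1)) := by
  have hs : √(2 : ℝ) * √2 = 2 := sqrt_two_mul_self
  have hs0 : 0 < √(2 : ℝ) := by positivity
  have hs1 : 1 ≤ √(2 : ℝ) := one_le_sqrt_two
  obtain ⟨B, hB⟩ := exists_nat_ge (v 0 + v 1)
  have key := h.bound_or_vertex B 0 hv hv0 hv1 hB
  have hone : (pathMat w 0 : Matrix (Fin 2) (Fin 2) ℝ) *ᵥ v = v := by simp [pathMat]
  rw [hone, exists_or] at key
  rcases key with key | key | key
  · left
    nlinarith
  · classical
    have hmin := fun m => Nat.find_min key (m := m)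
    have hspec := Nat.find_spec key
    generalize Nat.find key = m at hmin hspec
    cases m with
    | zero => exact absurd (by rw [hspec]; simp [pathMat]) h1
    | succ j =>
      have hj : w j ≠ .R := by
        intro hR
        refine hmin j (Nat.lt_succ_self j) ?_
        rw [hspec, pathMat_succ_mulVec, hR]
        congr 1
        simp only [Digit.mat]
        rw [unip_mulVec]
        simp
      by_cases hRRR : w (j + 1) = .R ∧ w (j + 2) = .R ∧ w (j + 3) = .R
      · exact Or.inr ⟨j, hj, hRRR.1, hRRR.2.1, hRRR.2.2, hspec⟩
      · left
        have hX := h.X_le_three hRRR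
        have hP : P (j + 1) ≤ 1 := by rw [h.actP]; exact Digit.act_le_one hj (h.nonnegP j)
        have hX0 := h.posX (j + 1)
        have hP0 := h.nonnegP (j + 1)
        rw [hspec, h.eval_pathMat, rootForm_eval_e1, abs_of_pos (by positivity), mul_one_div,
          le_div_iff₀ (by positivity)]
        nlinarith
  · classical
    have hmin := fun m => Nat.find_min key (m := m)
    have hspec := Nat.find_spec key
    generalize Nat.find key = m at hmin hspec
    cases m with
    | zero => exact absurd (by rw [hspec]; simp [pathMat]) h2
    | succ j =>
      have hj : w j ≠ .L := by
        intro hL'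
        refine hmin j (Nat.lt_succ_self j) ?_
        rw [hspec, pathMat_succ_mulVec, hL']
        congr 1
        rw [mulVec_eq]
        simp [Digit.mat]
      left
      have hX := h.sixth_le_X (hL (j + 1))
      have hP : 1 / 2 ≤ P (j + 1) := by rw [h.actP]; exact Digit.half_le_act hj (h.nonnegP j)
      rw [hspec, h.eval_pathMat, rootForm_eval_e2]
      generalize P (j + 1) = p at *
      generalize X (j + 1) = x at *
      have hx : 0 < x := by linarith
      have hp : 0 < p := by linarith
      rw [neg_div, abs_neg, abs_of_pos (by positivity),
        ← mul_div_assoc, le_div_iff₀ (by positivity)]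
      have e : 4 * √2 * (√2 * x * p) = 8 * (x * p) := by linear_combination 4 * x * p * hs
      rw [e]
      nlinarith

theorem bound (h : DigitPath w X P) (hL : ∀ n, ¬ (w n = .L ∧ w (n + 1) = .L ∧ w (n + 2) = .L))
    {v : Fin 2 → ℝ} (hv : IsCuspVector v) (h0 : v 0 ≠ 0) (h1 : v 1 ≠ 0) :
    1 ≤ 4 * √2 * |(rootForm (X 0) (P 0)).eval v| ∨
      ∃ j, w j ≠ .R ∧ w (j + 1) = .R ∧ w (j + 2) = .R ∧ w (j + 3) = .R ∧
        (v = firstCol (pathMat w (j + 1)) ∨ v = -firstCol (pathMat w (j + 1))) := by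
  wlog hpos : 0 < v 1 generalizing v
  · have := this hv.neg (by simpa using h0) (by simpa using h1)
      (by simpa using lt_of_le_of_ne (not_lt.1 hpos) h1)
    rw [BinForm.eval_neg] at this
    simpa only [neg_eq_iff_eq_neg, neg_neg, or_comm] using this
  rcases lt_or_gt_of_ne h0 with hneg | hpos'
  · left
    have h2 := hv.one_le_abs_zero h0
    have h3 := hv.one_le_abs_one h1
    rw [abs_of_neg hneg] at h2
    rw [abs_of_pos hpos] at h3
    have hX := h.posX 0
    have hs0 : 0 < √(2 : ℝ) := by positivity
    have hs1 : 1 ≤ √(2 : ℝ) := one_le_sqrt_two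
    -- The roots are `√2 X 0` and `0`, so both factors are negative here and the product has no
    -- cancellation.
    have hQ : 1 ≤ |(rootForm (X 0) (P 0)).eval v| := by
      rw [rootForm_eval (by rw [h.zeroP]; linarith), h.zeroP]
      refine le_trans ?_ (le_abs_self _)
      rw [le_div_iff₀ (by positivity)]
      have : 0 < √2 * X 0 := by positivity
      nlinarith [mul_nonneg this.le (sub_nonneg.2 h3), mul_nonneg this.le (sub_nonneg.2 h2)]
    nlinarith
  · refine (h.bound_of_nonneg hL hv ?_ ?_ hpos'.le hpos.le).imp_right ?_
    · rintro rfl; simp at h1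
    · rintro rfl; simp at h0
    · rintro ⟨j, a, b, c, d, e⟩; exact ⟨j, a, b, c, d, Or.inl e⟩

end DigitPath

/-! ### The limit superior along Hall's word -/

theorem exists_hall_path {D D' : ℕ → Digit} {Y Y' : ℕ → ℝ} {x y : ℝ} (hx : Expansion x D Y)
    (hy : Expansion y D' Y') {N : ℕ} (hN : 1 ≤ N) :
    ∃ w X P, DigitPath w X P ∧ (∀ k, w (blockStart N k) = .M) ∧
      (∀ n, ¬ (w n = .L ∧ w (n + 1) = .L ∧ w (n + 2) = .L)) ∧
      (∀ n, w n ≠ .R → w (n + 1) = .R → w (n + 2) = .R → w (n + 3) = .R →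
        ∃ k, n = blockStart N k + k) ∧
      Filter.Tendsto (fun k => X (blockStart N k + k + 1) + P (blockStart N k + k + 1))
        Filter.atTop (nhds (N + x + y)) := by
  set w := hallWord D' D N with hw
  have hM : ∀ k, w (blockStart N k) = .M := hallWord_start D' D
  obtain ⟨X, hX⟩ := exists_tails (e := w) fun n => by
    obtain ⟨m, hm⟩ := Nat.exists_eq_add_of_le ((blockStart_strictMono N).id_le n)
    exact ⟨m, by rw [show n + m = blockStart N n from hm.symm]; exact hM n⟩
  set P : ℕ → ℝ := fun n => Nat.rec 0 (fun n p => (w n).act p) n with hPdef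
  have hpath : DigitPath w X P := ⟨fun n => (hX n).1, fun n => (hX n).2, rfl, fun n => rfl⟩
  -- Only `P 0` vanishes, because the word begins with `M`; the comparison with `y` below reaches
  -- back to index `blockStart N k + 1` and not further.
  have hPpos : ∀ n, 0 < P (n + 1) := by
    intro n
    induction n with
    | zero =>
      rw [hpath.actP, hpath.zeroP, show w 0 = .M from by simpa [blockStart] using hM 0]
      simp [Digit.act]
    | succ n ih => rw [hpath.actP]; exact Digit.act_pos _ ih
  refine ⟨w, X, P, hpath, hM, hallWord_noL hN hy.noL hx.noL,
    fun n => hallWord_run_start hy.first hy.noR hx.noR, ?_⟩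
  have hrun : ∀ k i, i ≤ N →
      X (blockStart N k + k + 1) = i + X (blockStart N k + (k + 1 + i)) := by
    intro k i
    induction i with
    | zero => intro _; simp [add_assoc]
    | succ i ih =>
      intro hi
      rw [ih (by omega), hpath.actX (blockStart N k + (k + 1 + i)), hw,
        hallWord_run D' D (by omega) (by omega), actR]
      push_cast
      rw [show blockStart N k + (k + 1 + i) + 1 = blockStart N k + (k + 1 + (i + 1)) by ring]
      ring
  -- After the run, the next `k` digits are those of `x`.
  have hbX : ∀ k, 0 < k → |X (blockStart N k + (k + 1 + N)) - x| ≤ 1 / k := by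
    intro k hk
    have := abs_sub_le_of_digits_eq hx.first (z := fun i => X (blockStart N k + (k + 1 + N) + i))
      (z' := Y) (fun i _ => hpath.posX _) (fun i hi => ?_) (fun i _ => hx.pos i)
      (fun i _ => hx.act i) hk
    · rwa [hx.zero] at this
    · rw [hpath.actX, hw, add_assoc, add_assoc, hallWord_right D' D (by omega) (by omega),
        show k + 1 + (N + i) - k - N - 1 = i by omega,
        show blockStart N k + (k + 1 + (N + i)) + 1 = blockStart N k + (k + 1 + N) + (i + 1) by ring]
  -- Read backwards from the run, the preceding `k` digits are those of `y`, since the word stores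
  -- them reversed.
  have hbP : ∀ k, 0 < k → |P (blockStart N k + k + 1) - y| ≤ 1 / k := by
    intro k hk
    have := abs_sub_le_of_digits_eq hy.first (z := fun i => P (blockStart N k + (k - i) + 1))
      (z' := Y') (fun i _ => hPpos _) (fun i hi => ?_) (fun i _ => hy.pos i)
      (fun i _ => hy.act i) hk
    · rwa [hy.zero] at this
    · rw [hpath.actP, hw, hallWord_left D' D (by omega) (by omega),
        show k - (k - i) = i by omega, show k - i = k - (i + 1) + 1 by omega]
      rfl
  refine tendsto_iff_dist_tendsto_zero.2 (squeeze_zero' (Filter.Eventually.of_forall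
    fun _ => dist_nonneg) ?_ (?_ : Filter.Tendsto (fun k : ℕ => 2 * (1 / (k : ℝ))) _ _))
  · filter_upwards [Filter.eventually_gt_atTop 0] with k hk
    rw [Real.dist_eq, hrun k N le_rfl]
    have h1 := abs_le.1 (hbX k hk)
    have h2 := abs_le.1 (hbP k hk)
    exact abs_le.2 ⟨by linarith, by linarith⟩
  · simpa using tendsto_one_div_atTop_nhds_zero_nat.const_mul (2 : ℝ)

theorem pathMat_col (w : ℕ → Digit) (n : ℕ) : 0 ≤ pathMat w n 1 0 ∧ 0 < pathMat w n 1 1 ∧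
    pathMat w n 1 0 ≤ pathMat w (n + 1) 1 0 ∧
    (w n = .M → pathMat w n 1 0 < pathMat w (n + 1) 1 0) := by
  have hs1 : 1 ≤ √(2 : ℝ) := one_le_sqrt_two
  have hmul : ∀ n j, pathMat w (n + 1) 1 j =
      pathMat w n 1 0 * (w n).mat 0 j + pathMat w n 1 1 * (w n).mat 1 j := fun n j => by
    have : ((pathMat w (n + 1) : SL(2, ℝ)) : Matrix (Fin 2) (Fin 2) ℝ) =
      (pathMat w n : Matrix (Fin 2) (Fin 2) ℝ) * (w n).mat := Matrix.SpecialLinearGroup.coe_mul _ _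
    rw [this, Matrix.mul_apply, Fin.sum_univ_two]
  have hpos : 0 ≤ pathMat w n 1 0 ∧ 0 < pathMat w n 1 1 := by
    induction n with
    | zero => simp [pathMat]
    | succ n ih =>
      obtain ⟨h1, h2⟩ := ih
      rw [hmul, hmul]
      cases w n <;> simp [Digit.mat, unip] <;> constructor <;> positivity
  obtain ⟨h1, h2⟩ := hpos
  refine ⟨h1, h2, ?_, fun hM => ?_⟩
  · rw [hmul]
    cases w n <;> simp [Digit.mat, unip] <;> nlinarith
  · rw [hmul, hM]
    simp [Digit.mat]
    nlinarith

/-- The second entry of the first column never decreases along the path and grows at each `M`. The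
vectors at the runs are therefore distinct, as a limit superior over vectors requires. -/
theorem pathMat_col_strictMono {w : ℕ → Digit} {N : ℕ} (hM : ∀ k, w (blockStart N k) = .M) :
    StrictMono fun k => pathMat w (blockStart N k + k + 1) 1 0 := by
  have hmono : Monotone fun n => pathMat w n 1 0 :=
    monotone_nat_of_le_succ fun n => (pathMat_col w n).2.2.1
  refine strictMono_nat_of_lt_succ fun k => ?_
  by_cases hk : blockStart N k + k + 1 ≤ blockStart N (k + 1)
  · exact (hmono hk).trans_lt (((pathMat_col w _).2.2.2 (hM (k + 1))).trans_le
      (hmono (by omega)))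
  · exact absurd (blockStart_succ N k) (by omega)

theorem lagrangeValue_hall {D D' : ℕ → Digit} {Y Y' : ℕ → ℝ} {x y : ℝ} (hx : Expansion x D Y)
    (hy : Expansion y D' Y') {N : ℕ} (hN : 1 ≤ N) (h4 : 4 < N + x + y) :
    √2 * (N + x + y) ∈ lagrangeSpectrum (heckeGroup 4) := by
  obtain ⟨w, X, P, h, hM, hL, hR, hlim⟩ := exists_hall_path hx hy hN
  have hs0 : 0 < √(2 : ℝ) := by positivity
  set t := √2 * (N + x + y) with ht
  have ht4 : 4 * √2 < t := by rw [ht]; nlinarith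
  set f := rootForm (X 0) (P 0) with hf
  set g : ℕ → (Fin 2 → ℝ) := fun k => firstCol (pathMat w (blockStart N k + k + 1)) with hg
  have hfg : ∀ k, f.eval (g k) =
      1 / (√2 * (X (blockStart N k + k + 1) + P (blockStart N k + k + 1))) := by
    intro k
    have : g k = (pathMat w (blockStart N k + k + 1) : Matrix (Fin 2) (Fin 2) ℝ) *ᵥ ![1, 0] := rfl
    rw [this, hf, h.eval_pathMat, rootForm_eval_e1]
  have hpos : ∀ n, 0 < √2 * (X n + P n) := fun n => by
    have := h.posX n
    have := h.nonnegP n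
    positivity
  have hdisc : f.disc = 1 := rootForm_disc (by have := h.posX 0; have := h.nonnegP 0; positivity)
  have hlim' : Filter.Tendsto
      (fun k => √2 * (X (blockStart N k + k + 1) + P (blockStart N k + k + 1)))
      Filter.atTop (nhds t) := hlim.const_mul _
  have hbound : ∀ v ∈ cuspOrbit (heckeGroup 4), v 0 ≠ 0 → v 1 ≠ 0 →
      1 ≤ 4 * √2 * |f.eval v| ∨ ∃ k, v = g k ∨ v = -g k := by
    intro v hv h0 h1
    refine (h.bound hL (isCuspVector_of_mem hv) h0 h1).imp_right ?_
    rintro ⟨j, a, b, c, d, e⟩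
    obtain ⟨k, rfl⟩ := hR j a b c d
    exact ⟨k, e⟩
  have hgmem : ∀ k, g k ∈ cuspOrbit (heckeGroup 4) := fun k => ⟨_, pathMat_mem _ _, rfl⟩
  have hginj : Function.Injective g := by
    intro k l hkl
    apply (pathMat_col_strictMono hM).injective
    simpa [hg, firstCol_eq] using congrFun hkl 1
  refine ⟨by positivity, f, by rw [hdisc]; exact one_pos, ?_, ?_⟩
  · rintro ⟨v, hv, v', hv', hdet, h0, h0'⟩
    -- The root `0` is a cusp, but the only one at which `f` vanishes: two orbit vectors on which
    -- `f` is zero are then proportional.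
    have key : ∀ v ∈ cuspOrbit (heckeGroup 4), f.eval v = 0 → v 0 = 0 := by
      intro v hv hv0
      by_contra hne
      by_cases h1 : v 1 = 0
      · have : f.eval v = 1 / (√2 * (X 0 + P 0)) := by
          rcases (isCuspVector_of_mem hv).eq_of_one_eq_zero h1 with rfl | rfl
          · rw [hf, rootForm_eval_e1]
          · rw [show (![-1, 0] : Fin 2 → ℝ) = -![1, 0] by simp, BinForm.eval_neg, hf,
              rootForm_eval_e1]
        rw [this] at hv0
        exact absurd hv0 (one_div_pos.2 (hpos 0)).ne'
      · rcases hbound v hv hne h1 with h2 | ⟨k, rfl | rfl⟩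
        · rw [hv0] at h2; norm_num at h2
        · rw [hfg] at hv0
          exact absurd hv0 (one_div_pos.2 (hpos _)).ne'
        · rw [BinForm.eval_neg, hfg] at hv0
          exact absurd hv0 (one_div_pos.2 (hpos _)).ne'
    rw [key v hv h0, key v' hv' h0'] at hdet
    simp at hdet
  · have hd : 0 < √f.disc := by rw [hdisc]; simp
    apply le_antisymm
    · by_contra! hlt
      obtain ⟨r, hr0, hr1, hr2⟩ := ENNReal.lt_iff_exists_real_btwn.1 hlt
      have htr : t < r := (ENNReal.ofReal_lt_ofReal_iff_of_nonneg (by positivity)).1 hr1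
      refine absurd hr2 (not_lt.2 (Filter.limsup_le_of_le (by isBoundedDefault) ?_))
      obtain ⟨K, hK⟩ := Filter.eventually_atTop.1 (hlim'.eventually_lt_const htr)
      -- The vectors allowed to exceed `r`: those on the axes, where `(0, 1)` gives an infinite
      -- term, and the vectors at the first `K` runs, with signs.
      have hfin : ((({![1, 0], ![-1, 0]} : Set (Fin 2 → ℝ)) ∪ {![0, 1], ![0, -1]}) ∪
          (g '' Set.Iio K ∪ (fun k => -g k) '' Set.Iio K)).Finite :=
        ((Set.toFinite _).union (Set.toFinite _)).union
          (((Set.finite_Iio K).image _).union ((Set.finite_Iio K).image _))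
      rw [Filter.eventually_cofinite]
      refine (hfin.preimage Subtype.val_injective.injOn).subset ?_
      rintro ⟨v, hv⟩ hbad
      rw [Set.mem_ofPred_eq, ofReal_div_abs_le_iff hd hr0, hdisc, Real.sqrt_one, not_le] at hbad
      rw [Set.mem_preimage]
      by_cases h0 : v 0 = 0
      · exact Or.inl (Or.inr ((isCuspVector_of_mem hv).eq_of_zero_eq_zero h0))
      by_cases h1 : v 1 = 0
      · exact Or.inl (Or.inl ((isCuspVector_of_mem hv).eq_of_one_eq_zero h1))
      have hlarge : ∀ k, |f.eval v| = |f.eval (g k)| → k < K := by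
        intro k hk
        by_contra! hle
        rw [hk, hfg, abs_of_pos (one_div_pos.2 (hpos _)), mul_one_div, div_lt_one (hpos _)] at hbad
        exact absurd (hK k hle) hbad.not_gt
      rcases hbound v hv h0 h1 with h2 | ⟨k, rfl | rfl⟩
      · exfalso
        have : 4 * √2 * |f.eval v| ≤ r * |f.eval v| :=
          mul_le_mul_of_nonneg_right (by linarith) (abs_nonneg _)
        linarith
      · exact Or.inr (Or.inl ⟨k, hlarge k rfl, rfl⟩)
      · exact Or.inr (Or.inr ⟨k, hlarge k (by rw [BinForm.eval_neg]), rfl⟩)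
    · by_contra! hlt
      obtain ⟨r, hr0, hr1, hr2⟩ := ENNReal.lt_iff_exists_real_btwn.1 hlt
      have htr : r < t := (ENNReal.ofReal_lt_ofReal_iff_of_nonneg hr0).1 hr2
      refine absurd hr1 (not_lt.2 (Filter.le_limsup_of_frequently_le ?_ (by isBoundedDefault)))
      obtain ⟨K, hK⟩ := Filter.eventually_atTop.1 (hlim'.eventually_const_lt htr)
      rw [Filter.frequently_cofinite_iff_infinite]
      refine Set.infinite_of_injective_forall_mem
        (f := fun k => (⟨g (k + K), hgmem _⟩ : cuspOrbit (heckeGroup 4))) ?_ ?_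
      · intro k l hkl
        exact Nat.add_right_cancel (hginj (congrArg Subtype.val hkl))
      · intro k
        have h1 := hK (k + K) (Nat.le_add_left _ _)
        rw [Set.mem_ofPred_eq, hfg, abs_of_pos (one_div_pos.2 (hpos _)),
          ← ENNReal.ofReal_div_of_pos (one_div_pos.2 (hpos _)), hdisc, Real.sqrt_one, one_div_one_div]
        exact ENNReal.ofReal_le_ofReal h1.le

theorem Ioi_subset_lagrangeSpectrum :
    Set.Ioi (4 * √(2 : ℝ)) ⊆ lagrangeSpectrum (heckeGroup 4) := by
  intro t ht
  have ht : 4 * √2 < t := ht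
  have hs0 : 0 < √(2 : ℝ) := by positivity
  have hτ : 4 < t / √2 := by rwa [lt_div_iff₀ hs0]
  -- The shift by `1/2` puts `t / √2 - N` into `[1/2, 3/2)`, the window covered by the sums `x + y`.
  set N := ⌊t / √2 - 1 / 2⌋₊ with hNdef
  have hN1 : (N : ℝ) ≤ t / √2 - 1 / 2 := Nat.floor_le (by linarith)
  have hN2 : t / √2 - 1 / 2 < N + 1 := Nat.lt_floor_add_one _
  have hN : 1 ≤ N := Nat.le_floor (by push_cast; linarith)
  obtain ⟨x, y, hxy, hx, hy⟩ := exists_add_eq (t := t / √2 - N) (by linarith) (by linarith)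
  obtain ⟨D, Y, hD⟩ := exists_expansion hx
  obtain ⟨D', Y', hD'⟩ := exists_expansion hy
  have hsum : (N : ℝ) + x + y = t / √2 := by linarith
  have := lagrangeValue_hall hD hD' hN (by rw [hsum]; exact hτ)
  rwa [hsum, mul_div_cancel₀ _ hs0.ne'] at this
theorem mainTheorem2 :
    Set.Ioi (4 * √(2 : ℝ)) ⊆ lagrangeSpectrum (heckeGroup 4) ∧
      lagrangeSpectrum (heckeGroup 4) ⊆ markoffSpectrum (heckeGroup 4) :=
  ⟨Ioi_subset_lagrangeSpectrum, lagrangeSpectrum_subset_markoffSpectrum⟩
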